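/- **Setting.** A *constraint* over $[n]$ is a downwards-closed family $\mathcal F\subseteq 2^{[n]}$ with $\emptyset\in\mathcal F$. *MC-CICS.* An instance $\mathbb I=(\mathcal F,\mathbb M)$ consists of a constraint and finite acyclic Markov chains $\mathbb M=(\mathcal M_1,\dots,\mathcal M_n)$. Each non-terminal state $s$ has a single action, of cost $c(s)\ge 0$, leading to a random new state; each terminal state $t$ has a value $v(t)\in\mathbb R$. A policy adaptively (possibly using fair coin tosses) either advances a chain that is in a non-terminal state, paying the cost and observing the new state, or halts by selecting a set $S\in\mathcal F$ of chains that are in terminal states, collecting their values. $\mathrm{Util}_{\mathbb I}$ is the expected value collected minus the expected cost paid, and $\mathrm{OPT}(\mathbb I)$ is the supremum of $\mathrm{Util}_{\mathbb I}$ over all policies. The size of an instance is the total number of states and actions. *Surrogate values.* They are obtained by draining costs: from the bottom of the chain upwards, for each non-terminal state $s$, the (already drained) random terminal value $W$ of a walk from $s$ is truncated at the level $\ell$ at which $\mathbb E[(W-\ell)^+]=c(s)$ (at the maximum of $W$ if $c(s)=0$). The surrogate value of a complete trajectory is its terminal value after the truncations at all its states (a function $w(t)$ of the terminal state $t$ if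 only one trajectory leads to $t$), and the index $g$ of a trajectory is the largest surrogate value of a complete trajectory that extends it with positive probability. A policy satisfies *promise of payment* if, on every possible execution, when it halts every chain is selected, or was never advanced, or its index strictly decreased in the last step taken in it. *BCS.* For a product $\mathcal D=D_1\times\dots\times D_n$ of finitely supported distributions on $\mathbb R$, $\mathrm{ExPost}(\mathcal F,\mathcal D)=\mathbb E_{x\sim\mathcal D}\big[\max_{S\in\mathcal F}\sum_{i\in S}x_i\big]$. A semi-online algorithm starts from $S=\emptyset$ and repeatedly either halts or picks $i\notin S$ with $S\cup\{i\}\in\mathcal F$ and a threshold $\tau$, learns only whether $x_i\ge\tau$, and if so must add $i$ to $S$; it may repeat elements, and may use fair coins. $\mathrm{Val}_{\mathcal F,\mathcal D}$ is the expected total value of the accepted elements. The size of $\mathcal D$ is the total size of the supports. *Efficiency.* An efficient algorithm is one single program, in a list-processing language with rational constants and exact unit-cost real arithmetic and comparisons, that receives the instance and carries out the policy (or the semi-online algorithm) interactively in a total number of steps polynomial in the size of the instance. Constraints may come as a family $(\mathcal F_a)_{a\in\iota}$, each given to the program through some code whose size is added to the size of the instance; a single fixed constraint is the case $|\iota|=1$.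 **Theorem.** Fix a constraint $\mathcal F$ (or, more generally, a family of constraints given by codes), $\alpha>0$ and $\epsilon>0$. Suppose that there is an efficient MC-CICS policy $\mathcal T$ that satisfies promise of payment and $\mathrm{OPT}(\mathbb I)\le\alpha\,\mathrm{Util}_{\mathbb I}(\mathcal T)$ on every instance $\mathbb I=(\mathcal F,\mathbb M)$ (for every $\mathcal F$ in the family). Then there is an efficient semi-online algorithm $\mathrm B$ with $$\mathrm{ExPost}(\mathcal F,\mathcal D)\le(\alpha+\epsilon)\,\mathrm{Val}_{\mathcal F,\mathcal D}(\mathrm B)$$ for all finitely supported product distributions $\mathcal D$ (and every $\mathcal F$ in the family). The same holds if coin tosses are forbidden for both $\mathcal T$ and $\mathrm B$. -/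

import Mathlib

noncomputable section

namespace CICS

/-! ## Combinatorial constraints and finitely supported distributions -/

/-- A (non-empty) downwards-closed feasibility constraint over the alternatives `0, …, n - 1`. -/
structure Constraint (n : ℕ) where
  sets : Finset (Finset (Fin n))
  empty_mem : ∅ ∈ sets
  down_closed : ∀ S ∈ sets, ∀ R, R ⊆ S → R ∈ sets

/-- A finitely supported distribution over the reals: its support in increasing order, and the
(positive) probability of each point of the support. -/
structure Distribution where
  supportSize : ℕ
  point : Fin supportSize → ℝ
  prob : Fin supportSize → ℝ
  point_strictMono : StrictMono point
  prob_pos : ∀ j, 0 < prob j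
  prob_sum : ∑ j, prob j = 1

/-- Expectation of `f x` for `x` drawn from the product distribution `D 0 × ⋯ × D (n - 1)`. -/
def expect {n : ℕ} (D : Fin n → Distribution) (f : (Fin n → ℝ) → ℝ) : ℝ :=
  ∑ ω : (i : Fin n) → Fin (D i).supportSize,
    (∏ i, (D i).prob (ω i)) * f (fun i => (D i).point (ω i))

/-- The ex post optimum `E[max_{S ∈ F} ∑_{i ∈ S} x_i]`. -/
def exPost {n : ℕ} (F : Constraint n) (D : Fin n → Distribution) : ℝ :=
  expect D fun x => F.sets.sup' ⟨∅, F.empty_mem⟩ fun S => ∑ i ∈ S, x i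

/-! ## Semi-online selection algorithms -/

/-- The decision tree of a semi-online algorithm on a given instance: it halts, or it probes
element `i` with threshold `τ` and continues with `acc` if `x i ≥ τ` (the element is then
accepted) and with `rej` otherwise, or it tosses a fair coin. The only information about the
values on which the continuation can depend is the outcome of the comparisons. -/
inductive SemiOnline (n : ℕ) : Type
  | halt : SemiOnline n
  | probe (i : Fin n) (τ : ℝ) (acc rej : SemiOnline n) : SemiOnline n
  | toss (next : Bool → SemiOnline n) : SemiOnline n

/-- Legality of a semi-online algorithm that has accepted `S` so far: it only probes elements
`i ∉ S` with `S ∪ {i}` feasible; it may toss coins only if `coins = true`. -/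
def SemiOnline.ValidFrom {n : ℕ} (F : Constraint n) (coins : Bool) :
    SemiOnline n → Finset (Fin n) → Prop
  | .halt, _ => True
  | .probe i _ acc rej, S =>
      i ∉ S ∧ insert i S ∈ F.sets ∧ acc.ValidFrom F coins (insert i S) ∧ rej.ValidFrom F coins S
  | .toss next, S => coins = true ∧ ∀ b, (next b).ValidFrom F coins S

def SemiOnline.Valid {n : ℕ} (F : Constraint n) (coins : Bool) (β : SemiOnline n) : Prop :=
  β.ValidFrom F coins ∅

/-- Total value of the accepted elements when the values are `x`, averaged over the coins. -/
def SemiOnline.gain {n : ℕ} (x : Fin n → ℝ) : SemiOnline n → ℝ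
  | .halt => 0
  | .probe i τ acc rej => if τ ≤ x i then x i + acc.gain x else rej.gain x
  | .toss next => ((next true).gain x + (next false).gain x) / 2

/-- The expected total value `Val(β)` obtained on values drawn from `D`. -/
def SemiOnline.val {n : ℕ} (D : Fin n → Distribution) (β : SemiOnline n) : ℝ :=
  expect D fun x => β.gain x

/-! ## Markov chains with costs, surrogate values, indices -/

/-- A finite acyclic Markov chain with costs. Acyclicity is expressed by numbering the states
in a topological order: transitions go from larger to smaller numbers. Each non-terminal state
has a single action, of cost `cost s`. (The fields `cost` and `trans` are not used at terminal
states and `value` is not used at non-terminal states.) -/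
structure MarkovChain where
  numStates : ℕ
  root : Fin numStates
  terminals : Finset (Fin numStates)
  cost : Fin numStates → ℝ
  trans : Fin numStates → Fin numStates → ℝ
  value : Fin numStates → ℝ
  cost_nonneg : ∀ s, s ∉ terminals → 0 ≤ cost s
  trans_nonneg : ∀ s, s ∉ terminals → ∀ r, 0 ≤ trans s r
  trans_sum : ∀ s, s ∉ terminals → ∑ r, trans s r = 1
  trans_lt : ∀ s, s ∉ terminals → ∀ r, 0 < trans s r → r < s

namespace MarkovChain

/-- Number of states plus number of actions. -/
def size (C : MarkovChain) : ℕ := C.numStates + C.terminalsᶜ.card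

/-- A trajectory: the current state and the list of the earlier states, latest first. -/
abbrev Trajectory (C : MarkovChain) : Type := Fin C.numStates × List (Fin C.numStates)

/-- Water draining. `C.waterAbove s y` is `E[(W - y)⁺]`, the expected amount of value above
height `y` seen by a walk from `s`, where `W` is the terminal value reached, after the costs of
`s` and of all states below it have been drained. At a terminal state `W` is its value. At a
non-terminal state `s`, the amount above `y` before paying for `s` is the average of the amounts
at the successors; then a total of `cost s` is drained from the top (`W` is truncated at the
height at which the amount removed equals `cost s`), so the amount left above `y` is the
positive part of the difference. -/
def waterAbove (C : MarkovChain) (s : Fin C.numStates) (y : ℝ) : ℝ :=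
  if s ∈ C.terminals then max (C.value s - y) 0
  else max ((∑ r : Fin C.numStates,
    if h : r < s then C.trans s r * C.waterAbove r y else 0) - C.cost s) 0
termination_by s.val
decreasing_by exact h

/-- The height of the water surface after draining at `s`: values reached through `s` are
truncated at this height. At a terminal state it is the value of the state. -/
def level (C : MarkovChain) (s : Fin C.numStates) : ℝ :=
  sInf {y : ℝ | C.waterAbove s y = 0}

/-- The surrogate value of a trajectory that ends in a terminal state `t`: the value of `t`
after it has been truncated by the draining at every state of the trajectory. If only one
trajectory leads to `t`, this is the surrogate value `w(t)` of `t`. -/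
def surrogate (C : MarkovChain) (x : C.Trajectory) : ℝ :=
  (x.2.map C.level).foldr min (C.level x.1)

/-- `C.Extends x z`: a walk that has followed the trajectory `x` can continue to `z`. -/
inductive Extends (C : MarkovChain) (x : C.Trajectory) : C.Trajectory → Prop
  | refl : Extends C x x
  | step {s : Fin C.numStates} {l : List (Fin C.numStates)} {r : Fin C.numStates} :
      Extends C x (s, l) → s ∉ C.terminals → 0 < C.trans s r → Extends C x (r, s :: l)

/-- The index: the largest surrogate value over the terminal states that are still reachable. -/
def index (C : MarkovChain) (x : C.Trajectory) : ℝ :=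
  sSup {w : ℝ | ∃ z : C.Trajectory, C.Extends x z ∧ z.1 ∈ C.terminals ∧ w = C.surrogate z}

end MarkovChain

/-! ## Policies for selection with costly information over Markov chains -/

/-- The decision tree of a policy on the chains `M`: it halts and selects a set, or advances
a chain and continues according to the new state, or tosses a fair coin. -/
inductive Policy {n : ℕ} (M : Fin n → MarkovChain) : Type
  | halt (S : Finset (Fin n)) : Policy M
  | advance (i : Fin n) (next : Fin (M i).numStates → Policy M) : Policy M
  | toss (next : Bool → Policy M) : Policy M

/-- The joint history: one trajectory for each chain. -/
abbrev History {n : ℕ} (M : Fin n → MarkovChain) : Type := (i : Fin n) → (M i).Trajectory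

def History.init {n : ℕ} (M : Fin n → MarkovChain) : History M := fun i => ((M i).root, [])

/-- Chain `i` moves to the state `r`. -/
def History.move {n : ℕ} {M : Fin n → MarkovChain} (h : History M) (i : Fin n)
    (r : Fin (M i).numStates) : History M :=
  Function.update h i (r, (h i).1 :: (h i).2)

namespace Policy

variable {n : ℕ} {M : Fin n → MarkovChain}

/-- Legality along all possible executions: only chains in non-terminal states are advanced, the
set selected is feasible and consists of chains in terminal states, and coins are tossed only if
`coins = true`. -/
def ValidFrom (F : Constraint n) (coins : Bool) : Policy M → History M → Prop
  | .halt S, h => S ∈ F.sets ∧ ∀ i ∈ S, (h i).1 ∈ (M i).terminals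
  | .advance i next, h => (h i).1 ∉ (M i).terminals ∧
      ∀ r, 0 < (M i).trans (h i).1 r → (next r).ValidFrom F coins (h.move i r)
  | .toss next, h => coins = true ∧ ∀ b, (next b).ValidFrom F coins h

def Valid (F : Constraint n) (coins : Bool) (π : Policy M) : Prop :=
  π.ValidFrom F coins (History.init M)

/-- Expected value of the selected set minus expected cost of the actions still to come. -/
def utilityFrom : Policy M → History M → ℝ
  | .halt S, h => ∑ i ∈ S, (M i).value (h i).1
  | .advance i next, h => -(M i).cost (h i).1 +
      ∑ r, (M i).trans (h i).1 r * (next r).utilityFrom (h.move i r)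
  | .toss next, h => ((next true).utilityFrom h + (next false).utilityFrom h) / 2

def utility (π : Policy M) : ℝ := π.utilityFrom (History.init M)

/-- On every possible execution, whenever the policy halts, every chain is selected, or has never
been advanced, or its index decreased in the last step that was taken in it. -/
def PromiseFrom : Policy M → History M → Prop
  | .halt S, h => ∀ i, i ∈ S ∨ (h i).2 = [] ∨
      ∃ s l, (h i).2 = s :: l ∧ (M i).index (h i) < (M i).index (s, l)
  | .advance i next, h =>
      ∀ r, 0 < (M i).trans (h i).1 r → (next r).PromiseFrom (h.move i r)
  | .toss next, h => ∀ b, (next b).PromiseFrom h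

def PromiseOfPayment (π : Policy M) : Prop := π.PromiseFrom (History.init M)

end Policy

/-- The optimal utility over all (adaptive, randomized) policies. -/
def opt {n : ℕ} (F : Constraint n) (M : Fin n → MarkovChain) : ℝ :=
  sSup {u : ℝ | ∃ π : Policy M, π.Valid F true ∧ u = π.utility}

/-! ## The machine model: list-processing programs with unit-cost real arithmetic -/

/-- Data: binary trees whose leaves are real numbers or `nil`. -/
inductive Data : Type
  | nil : Data
  | num (r : ℝ) : Data
  | cons (a b : Data) : Data

namespace Data

def size : Data → ℕ
  | .nil => 1
  | .num _ => 1
  | .cons a b => a.size + b.size + 1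

def ofList : List Data → Data
  | [] => .nil
  | a :: l => .cons a (ofList l)

/-- `nil` is false; everything else, in particular the number `1`, is true. -/
def ofBool : Bool → Data
  | false => .nil
  | true => .num 1

def ofFin {n : ℕ} (i : Fin n) : Data := .num ((i : ℕ) : ℝ)

end Data

/-- Programs. Each program maps data to data; the only constants are `nil` and rationals. -/
inductive Prog : Type
  | id | nil | fst | snd | add | sub | mul | div | lt | isCons : Prog
  | const (q : ℚ) : Prog
  | pair (p q : Prog) : Prog
  | comp (p q : Prog) : Prog
  | ite (c p q : Prog) : Prog
  | loop (c p : Prog) : Prog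

open Data in
/-- `Exec p x z t`: the program `p` on input `x` halts with output `z` after `t` steps. Every
elementary operation (building or reading a node, an arithmetic operation on or a comparison of
two reals, a branching) takes one step. Operations that make no sense (such as a division
by `0`) block, so there is no `z` and `t` then. -/
inductive Exec : Prog → Data → Data → ℕ → Prop
  | id (x : Data) : Exec .id x x 1
  | nil (x : Data) : Exec .nil x .nil 1
  | const (q : ℚ) (x : Data) : Exec (.const q) x (num (q : ℝ)) 1
  | fst (a b : Data) : Exec .fst (cons a b) a 1
  | snd (a b : Data) : Exec .snd (cons a b) b 1
  | add (a b : ℝ) : Exec .add (cons (num a) (num b)) (num (a + b)) 1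
  | sub (a b : ℝ) : Exec .sub (cons (num a) (num b)) (num (a - b)) 1
  | mul (a b : ℝ) : Exec .mul (cons (num a) (num b)) (num (a * b)) 1
  | div (a b : ℝ) : b ≠ 0 → Exec .div (cons (num a) (num b)) (num (a / b)) 1
  | lt_true (a b : ℝ) : a < b → Exec .lt (cons (num a) (num b)) (ofBool true) 1
  | lt_false (a b : ℝ) : ¬ a < b → Exec .lt (cons (num a) (num b)) (ofBool false) 1
  | isCons_cons (a b : Data) : Exec .isCons (cons a b) (ofBool true) 1
  | isCons_nil : Exec .isCons .nil (ofBool false) 1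
  | isCons_num (a : ℝ) : Exec .isCons (num a) (ofBool false) 1
  | pair {p q : Prog} {x y z : Data} {t u : ℕ} :
      Exec p x y t → Exec q x z u → Exec (.pair p q) x (cons y z) (t + u + 1)
  | comp {p q : Prog} {x y z : Data} {t u : ℕ} :
      Exec p x y t → Exec q y z u → Exec (.comp p q) x z (t + u + 1)
  | ite_true {c p q : Prog} {x y z : Data} {t u : ℕ} :
      Exec c x y t → y ≠ .nil → Exec p x z u → Exec (.ite c p q) x z (t + u + 1)
  | ite_false {c p q : Prog} {x z : Data} {t u : ℕ} :
      Exec c x .nil t → Exec q x z u → Exec (.ite c p q) x z (t + u + 1)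
  | loop_stop {c p : Prog} {x : Data} {t : ℕ} :
      Exec c x .nil t → Exec (.loop c p) x x (t + 1)
  | loop_step {c p : Prog} {x y z w : Data} {t u v : ℕ} :
      Exec c x y t → y ≠ .nil → Exec p x z u → Exec (.loop c p) z w v →
      Exec (.loop c p) x w (t + u + v + 1)

/-! ## Encoding of instances -/

open Data in
/-- The list of the states in the order of their numbers: a terminal state is given by its value,
a non-terminal one by its cost and the list of its possible successors with probabilities. -/
def MarkovChain.encode (C : MarkovChain) : Data :=
  cons (ofFin C.root) (ofList ((List.finRange C.numStates).map fun s =>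
    if s ∈ C.terminals then cons .nil (num (C.value s))
    else cons (num (C.cost s)) (ofList (((List.finRange C.numStates).filter
      fun r => 0 < C.trans s r).map fun r => cons (ofFin r) (num (C.trans s r))))))

open Data in
/-- The list of the support points, in increasing order, with their probabilities. -/
def Distribution.encode (D : Distribution) : Data :=
  ofList ((List.finRange D.supportSize).map fun j => cons (num (D.point j)) (num (D.prob j)))

def encodeChains {n : ℕ} (M : Fin n → MarkovChain) : Data :=
  Data.ofList ((List.finRange n).map fun i => (M i).encode)

def encodeDistributions {n : ℕ} (D : Fin n → Distribution) : Data :=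
  Data.ofList ((List.finRange n).map fun i => (D i).encode)

/-! ## Interactive algorithms

An algorithm is a program that is run once per round, on the pair of its current memory and the
answer to its latest request; it outputs its new memory and its next request. The number of
steps is summed over all rounds. -/

open Data in
/-- `π.RunBy T mem ans h t`: the program `T`, with memory `mem`, answer `ans` to its latest request
and joint history `h`, carries out the policy `π` on every possible execution, in a total of at
most `t` steps. -/
def Policy.RunBy {n : ℕ} {M : Fin n → MarkovChain} (T : Prog) :
    Policy M → Data → Data → History M → ℕ → Prop
  | .halt S, mem, ans, _, t =>
      ∃ (mem₁ : Data) (l : List (Fin n)) (u : ℕ), l.Nodup ∧ l.toFinset = S ∧ u ≤ t ∧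
        Exec T (cons mem ans) (cons mem₁ (cons (num 0) (ofList (l.map ofFin)))) u
  | .advance i next, mem, ans, h, t =>
      ∃ (mem₁ : Data) (u : ℕ), u ≤ t ∧
        Exec T (cons mem ans) (cons mem₁ (cons (num 1) (ofFin i))) u ∧
        ∀ r, 0 < (M i).trans (h i).1 r → (next r).RunBy T mem₁ (ofFin r) (h.move i r) (t - u)
  | .toss next, mem, ans, h, t =>
      ∃ (mem₁ : Data) (u : ℕ), u ≤ t ∧
        Exec T (cons mem ans) (cons mem₁ (cons (num 2) .nil)) u ∧
        ∀ b, (next b).RunBy T mem₁ (ofBool b) h (t - u)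

open Data in
/-- `β.RunBy B mem ans t`: the program `B`, with memory `mem` and answer `ans` to its latest
request, carries out the semi-online algorithm `β` in a total of at most `t` steps. -/
def SemiOnline.RunBy {n : ℕ} (B : Prog) : SemiOnline n → Data → Data → ℕ → Prop
  | .halt, mem, ans, t =>
      ∃ (mem₁ : Data) (u : ℕ), u ≤ t ∧
        Exec B (cons mem ans) (cons mem₁ (cons (num 0) .nil)) u
  | .probe i τ acc rej, mem, ans, t =>
      ∃ (mem₁ : Data) (u : ℕ), u ≤ t ∧
        Exec B (cons mem ans) (cons mem₁ (cons (num 1) (cons (ofFin i) (num τ)))) u ∧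
        acc.RunBy B mem₁ (ofBool true) (t - u) ∧ rej.RunBy B mem₁ (ofBool false) (t - u)
  | .toss next, mem, ans, t =>
      ∃ (mem₁ : Data) (u : ℕ), u ≤ t ∧
        Exec B (cons mem ans) (cons mem₁ (cons (num 2) .nil)) u ∧
        ∀ b, (next b).RunBy B mem₁ (ofBool b) (t - u)

/-- `T` is an efficient algorithm that carries out, for every constraint `F a` of the family and
all chains `M`, the (legal) policy `π a M`: it receives the code of the constraint and the
encoded chains, and its running time is polynomial in the size of the code plus the total number
of states and actions. -/
def EfficientPolicy {ι : Type*} {n : ι → ℕ} (F : (a : ι) → Constraint (n a)) (code : ι → Data)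
    (coins : Bool) (T : Prog) (π : (a : ι) → (M : Fin (n a) → MarkovChain) → Policy M) : Prop :=
  (∀ a M, (π a M).Valid (F a) coins) ∧
  ∃ P : Polynomial ℕ, ∀ a M,
    (π a M).RunBy T (Data.cons (code a) (encodeChains M)) Data.nil (History.init M)
      (P.eval ((code a).size + ∑ i, (M i).size))

/-- `B` is an efficient algorithm that carries out, for every constraint `F a` of the family and
all distributions `D`, the (legal) semi-online algorithm `β a D`, in time polynomial in the size
of the code plus the total size of the supports. -/
def EfficientSemiOnline {ι : Type*} {n : ι → ℕ} (F : (a : ι) → Constraint (n a))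
    (code : ι → Data) (coins : Bool) (B : Prog)
    (β : (a : ι) → (Fin (n a) → Distribution) → SemiOnline (n a)) : Prop :=
  (∀ a D, (β a D).Valid (F a) coins) ∧
  ∃ P : Polynomial ℕ, ∀ a D,
    (β a D).RunBy B (Data.cons (code a) (encodeDistributions D)) Data.nil
      (P.eval ((code a).size + ∑ i, (D i).supportSize))

end CICS

end

/-! A draw from a finitely supported distribution can be revealed free of charge by asking whether
it is at least the largest support point, then the next one, and so on. This is a Markov chain
without costs, so draining truncates nothing that is still reachable, and the level of a state is
the largest support point still possible. A successful test ends in a terminal state of the same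
level, so the index does not drop in that step. Promise of payment then forces the policy to select
every chain whose value it has revealed. Advancing a chain thus amounts to a semi-online probe, and
the policy becomes a semi-online algorithm (`Policy.toSemiOnline`), legal because the accepted
elements always lie in a set that some continuation selects (`Policy.finished_mem`).

Utility equals value: the utility from a history is the value already committed plus the conditional
mean of the gain to come (`Policy.utilityFrom_eq`), the conditional laws being explicit and
consistent along transitions (`Distribution.sum_trans_law`). On the other side, a policy may reveal
all draws at no cost and then choose the best set, whence `exPost_le_opt`. The guarantee of the
policy therefore transfers with the factor `α` itself.

For efficiency, a chain has two states per support point, so its code can be computed from that of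
the distribution. The simulating program does this once and keeps one stack per element, whose top
describes the current state of the chain while it is unfinished. Each round adds an overhead linear
in `n`, charged to the at least one step that the simulated program spends in that round
(`Policy.RunBy.simulate`). -/

namespace CICS

/-! ### Cumulative probabilities and the chain that reveals a draw. -/

namespace Distribution

variable (D : Distribution)

/-- The probability of the `j`-th support point, extended by `0`. -/
noncomputable def probNat (j : ℕ) : ℝ :=
  if h : j < D.supportSize then D.prob ⟨j, h⟩ else 0

/-- The `j`-th support point, extended by `0`. -/
noncomputable def pointNat (j : ℕ) : ℝ :=
  if h : j < D.supportSize then D.point ⟨j, h⟩ else 0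

/-- The total probability of the first `j` support points. -/
noncomputable def cumulative (j : ℕ) : ℝ := ∑ i ∈ Finset.range j, D.probNat i

theorem probNat_fin (j : Fin D.supportSize) : D.probNat j = D.prob j := by simp [probNat]

theorem pointNat_fin (j : Fin D.supportSize) : D.pointNat j = D.point j := by simp [pointNat]

theorem probNat_pos {j : ℕ} (h : j < D.supportSize) : 0 < D.probNat j := by
  simp [probNat, h, D.prob_pos]

theorem probNat_nonneg (j : ℕ) : 0 ≤ D.probNat j := by
  unfold probNat; split_ifs with h
  · exact (D.prob_pos _).le
  · exact le_rfl

theorem supportSize_pos : 0 < D.supportSize := by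
  rcases Nat.eq_zero_or_pos D.supportSize with h | h
  · have := D.prob_sum
    have : IsEmpty (Fin D.supportSize) := by rw [h]; infer_instance
    simp at *
  · exact h

theorem cumulative_zero : D.cumulative 0 = 0 := by simp [cumulative]

theorem cumulative_succ (j : ℕ) : D.cumulative (j + 1) = D.cumulative j + D.probNat j :=
  Finset.sum_range_succ _ _

theorem cumulative_nonneg (j : ℕ) : 0 ≤ D.cumulative j :=
  Finset.sum_nonneg fun i _ => D.probNat_nonneg i

theorem cumulative_succ_pos (j : ℕ) : 0 < D.cumulative (j + 1) :=
  (D.probNat_pos D.supportSize_pos).trans_le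
    (Finset.single_le_sum (f := D.probNat) (fun i _ => D.probNat_nonneg i) (by simp))

theorem cumulative_supportSize : D.cumulative D.supportSize = 1 := by
  rw [← D.prob_sum, cumulative, ← Fin.sum_univ_eq_sum_range]
  exact Finset.sum_congr rfl fun j _ => D.probNat_fin j

theorem pointNat_lt {i j : ℕ} (hij : i < j) (hj : j < D.supportSize) :
    D.pointNat i < D.pointNat j := by
  simp only [pointNat, hj, hij.trans hj, dif_pos]
  exact D.point_strictMono (by simpa using hij)

theorem pointNat_le {i j : ℕ} (hij : i ≤ j) (hj : j < D.supportSize) :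
    D.pointNat i ≤ D.pointNat j := by
  rcases hij.eq_or_lt with rfl | h
  · exact le_rfl
  · exact (D.pointNat_lt h hj).le

/-- Transition probabilities of the chain that reveals a draw by descending threshold tests. -/
noncomputable def transNat (s r : ℕ) : ℝ :=
  if r + 1 = s then D.probNat (s / 2) / D.cumulative (s / 2 + 1)
  else if r + 2 = s then D.cumulative (s / 2) / D.cumulative (s / 2 + 1) else 0

theorem transNat_nonneg (s r : ℕ) : 0 ≤ D.transNat s r := by
  unfold transNat
  have := D.probNat_nonneg (s / 2)
  have := D.cumulative_nonneg (s / 2)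
  have := D.cumulative_nonneg (s / 2 + 1)
  split_ifs <;> positivity

theorem sum_transNat {s : Fin (2 * D.supportSize)} (hs : ¬ (s : ℕ) % 2 = 0)
    (f : Fin (2 * D.supportSize) → ℝ) :
    ∑ r : Fin (2 * D.supportSize), D.transNat s r * f r =
      D.probNat (s / 2) / D.cumulative (s / 2 + 1) * f ⟨s - 1, by omega⟩ +
      D.cumulative (s / 2) / D.cumulative (s / 2 + 1) * f ⟨s - 2, by omega⟩ := by
  have hlt := s.2
  -- At `s = 1` truncated subtraction makes both successors the state `0`, and the second weight
  -- vanishes because `cumulative 0 = 0`.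
  by_cases h1 : (s : ℕ) = 1
  · rw [Fintype.sum_eq_single ⟨s - 1, by omega⟩]
    · simp [transNat, h1, cumulative_zero]
    · intro r hr
      have : (r : ℕ) ≠ s - 1 := fun h => hr (Fin.ext h)
      rw [transNat, if_neg (by omega), if_neg (by omega), zero_mul]
  · rw [Fintype.sum_eq_add ⟨s - 1, by omega⟩ ⟨s - 2, by omega⟩]
    · congr 2
      · rw [transNat, if_pos]; simp only; omega
      · rw [transNat, if_neg, if_pos] <;> simp only <;> omega
    · simp only [ne_eq, Fin.mk.injEq]; omega
    · rintro r ⟨hr, hr'⟩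
      have : (r : ℕ) ≠ s - 1 := fun h => hr (Fin.ext h)
      have : (r : ℕ) ≠ s - 2 := fun h => hr' (Fin.ext h)
      rw [transNat, if_neg (by omega), if_neg (by omega), zero_mul]

theorem transition_weights_add (j : ℕ) :
    D.probNat j / D.cumulative (j + 1) + D.cumulative j / D.cumulative (j + 1) = 1 := by
  rw [← add_div, add_comm, ← cumulative_succ, div_self (D.cumulative_succ_pos j).ne']

/-- The cost-free chain that reveals a draw from `D` by testing whether it is at least the largest
support point, then the next one, and so on. The state `2 * j + 1` is the one before the test for
the `j`-th support point; the terminal state `2 * j` says that the draw is that point. -/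
noncomputable def chain : MarkovChain where
  numStates := 2 * D.supportSize
  root := ⟨2 * D.supportSize - 1, by have := D.supportSize_pos; omega⟩
  terminals := Finset.univ.filter fun s => (s : ℕ) % 2 = 0
  cost _ := 0
  trans s r := D.transNat s r
  value s := D.pointNat (s / 2)
  cost_nonneg _ _ := le_rfl
  trans_nonneg _ _ _ := D.transNat_nonneg _ _
  trans_sum s hs := by
    have := D.sum_transNat (s := s) (by simpa using hs) fun _ => 1
    simpa [transition_weights_add] using this
  trans_lt s _ r hr := by
    unfold transNat at hr
    split_ifs at hr with h1 h2
    · exact Fin.lt_def.2 (by omega)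
    · exact Fin.lt_def.2 (by omega)
    · exact absurd hr (lt_irrefl _)

theorem chain_numStates : D.chain.numStates = 2 * D.supportSize := rfl

theorem mem_terminals {s : Fin D.chain.numStates} :
    s ∈ D.chain.terminals ↔ (s : ℕ) % 2 = 0 :=
  Finset.mem_filter.trans (and_iff_right (Finset.mem_univ _))

theorem half_lt (s : Fin D.chain.numStates) : (s : ℕ) / 2 < D.supportSize := by
  have : (s : ℕ) < 2 * D.supportSize := s.2
  omega

theorem chain_root : (D.chain.root : ℕ) = 2 * D.supportSize - 1 := rfl

theorem root_notMem_terminals : D.chain.root ∉ D.chain.terminals := by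
  have := D.supportSize_pos
  rw [mem_terminals, chain_root]; omega

/-- The state after the test at `s` has succeeded. -/
def yes {D : Distribution} (s : Fin D.chain.numStates) : Fin D.chain.numStates :=
  ⟨s - 1, by omega⟩

/-- The state after the test at `s` has failed (and the state `0` if the test at `s = 1` cannot
fail). -/
def no {D : Distribution} (s : Fin D.chain.numStates) : Fin D.chain.numStates :=
  ⟨s - 2, by omega⟩

section

variable {D} {s : Fin D.chain.numStates}

theorem yes_mem_terminals (hs : s ∉ D.chain.terminals) : yes s ∈ D.chain.terminals := by
  rw [mem_terminals] at *; simp only [yes]; omega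

theorem yes_half (hs : s ∉ D.chain.terminals) : (yes s : ℕ) / 2 = s / 2 := by
  rw [mem_terminals] at *; simp only [yes]; omega

theorem trans_yes_pos (hs : s ∉ D.chain.terminals) : 0 < D.chain.trans s (yes s) := by
  rw [mem_terminals] at hs
  have h1 := D.probNat_pos (D.half_lt s)
  have h2 := D.cumulative_succ_pos (s / 2)
  change 0 < D.transNat s (s - 1)
  rw [transNat, if_pos (by omega)]
  positivity

theorem cumulative_pos {j : ℕ} (hj : 0 < j) : 0 < D.cumulative j := by
  obtain ⟨i, rfl⟩ := Nat.exists_eq_succ_of_ne_zero hj.ne'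
  exact D.cumulative_succ_pos i

/-- At `s = 1` the test cannot fail, but `no s` is then `yes s`. So the failure branch of a
simulated probe always follows a possible transition, to which the legality and the promise of the
policy apply. -/
theorem trans_no_pos (hs : s ∉ D.chain.terminals) : 0 < D.chain.trans s (no s) := by
  by_cases h1 : (s : ℕ) = 1
  · have : no s = yes s := by ext; simp [yes, no, h1]
    rw [this]; exact trans_yes_pos hs
  · rw [mem_terminals] at hs
    have h3 : 0 < D.cumulative (s / 2) := cumulative_pos (by omega)
    have h2 := D.cumulative_succ_pos (s / 2)
    change 0 < D.transNat s (s - 2)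
    rw [transNat, if_neg (by omega), if_pos (by omega)]
    positivity

theorem sum_trans (hs : s ∉ D.chain.terminals) (f : Fin D.chain.numStates → ℝ) :
    ∑ r, D.chain.trans s r * f r =
      D.probNat (s / 2) / D.cumulative (s / 2 + 1) * f (yes s) +
      D.cumulative (s / 2) / D.cumulative (s / 2 + 1) * f (no s) :=
  D.sum_transNat (by rwa [mem_terminals] at hs) f

theorem eq_yes_of_trans_pos {r : Fin D.chain.numStates} (hs : s ∉ D.chain.terminals)
    (hr : r ∈ D.chain.terminals) (h : 0 < D.chain.trans s r) : r = yes s := by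
  rw [mem_terminals] at *
  change 0 < D.transNat s r at h
  unfold transNat at h
  ext
  simp only [yes]
  split_ifs at h with h1 h2
  · omega
  · omega
  · exact absurd h (lt_irrefl _)

/-! ### Levels and indices -/

theorem waterAbove_eq_zero (s : Fin D.chain.numStates) {y : ℝ} (hy : D.pointNat (s / 2) ≤ y) :
    D.chain.waterAbove s y = 0 := by
  induction s using WellFoundedLT.induction with
  | _ s ih =>
  rw [MarkovChain.waterAbove]
  split_ifs with hs
  · exact max_eq_right (sub_nonpos.2 hy)
  · have : ∀ r, (if h : r < s then D.chain.trans s r * D.chain.waterAbove r y else 0) = 0 := by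
      intro r
      split_ifs with h
      · rw [ih r h, mul_zero]
        exact (D.pointNat_le (Nat.div_le_div_right (Fin.lt_def.1 h).le) (D.half_lt s)).trans hy
      · rfl
    have hc : D.chain.cost s = 0 := rfl
    simp only [this, hc, Finset.sum_const_zero, sub_zero, max_self]

theorem waterAbove_nonneg (C : MarkovChain) (s : Fin C.numStates) (y : ℝ) :
    0 ≤ C.waterAbove s y := by
  rw [MarkovChain.waterAbove]; split_ifs <;> exact le_max_right _ _

/-- The terminal successor `yes s` carries the same support point and is reached with positive
probability; as costs are zero, nothing of its contribution is drained. -/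
theorem waterAbove_pos (s : Fin D.chain.numStates) {y : ℝ} (hy : y < D.pointNat (s / 2)) :
    0 < D.chain.waterAbove s y := by
  rw [MarkovChain.waterAbove]
  split_ifs with hs
  · exact lt_max_of_lt_left (sub_pos.2 hy)
  · refine lt_max_of_lt_left ?_
    have hlt : yes s < s := D.chain.trans_lt s hs _ (trans_yes_pos hs)
    have hc : D.chain.cost s = 0 := rfl
    rw [hc, sub_zero]
    refine Finset.sum_pos' (fun r _ => ?_) ⟨yes s, Finset.mem_univ _, ?_⟩
    · split_ifs
      · exact mul_nonneg (D.chain.trans_nonneg s hs r) (waterAbove_nonneg _ _ _)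
      · exact le_rfl
    · rw [dif_pos hlt]
      refine mul_pos (trans_yes_pos hs) ?_
      rw [MarkovChain.waterAbove, if_pos (yes_mem_terminals hs)]
      refine lt_max_of_lt_left (sub_pos.2 ?_)
      change y < D.pointNat ((yes s : ℕ) / 2)
      rwa [yes_half hs]

theorem level_eq (s : Fin D.chain.numStates) : D.chain.level s = D.pointNat (s / 2) := by
  have : {y : ℝ | D.chain.waterAbove s y = 0} = Set.Ici (D.pointNat (s / 2)) := by
    ext y
    simp only [Set.mem_ofPred_eq, Set.mem_Ici]
    refine ⟨fun h => ?_, waterAbove_eq_zero s⟩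
    by_contra hy
    exact (waterAbove_pos s (not_le.1 hy)).ne' h
  rw [MarkovChain.level, this, csInf_Ici]

end

end Distribution

/-! ### Surrogate values and indices along a trajectory. -/

theorem foldr_min_eq (l : List ℝ) (a b : ℝ) :
    l.foldr min (min a b) = min a (l.foldr min b) := by
  induction l with
  | nil => rfl
  | cons c l ih => rw [List.foldr_cons, ih, List.foldr_cons, min_left_comm]

namespace MarkovChain

variable {C : MarkovChain}

theorem surrogate_cons (r s : Fin C.numStates) (l : List (Fin C.numStates)) :
    C.surrogate (r, s :: l) = min (C.level r) (C.surrogate (s, l)) := by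
  simp only [surrogate, List.map_cons, List.foldr_cons]
  rw [← foldr_min_eq, ← foldr_min_eq, min_comm]

theorem Extends.surrogate_le {x z : C.Trajectory} (h : C.Extends x z) :
    C.surrogate z ≤ C.surrogate x := by
  induction h with
  | refl => exact le_rfl
  | step _ _ _ ih => rw [surrogate_cons]; exact (min_le_right _ _).trans ih

theorem Extends.eq_of_terminal {x z : C.Trajectory} (h : C.Extends x z)
    (hx : x.1 ∈ C.terminals) : z = x := by
  induction h with
  | refl => rfl
  | step _ hs _ ih => rw [← ih] at hx; exact absurd hx hs

theorem index_of_terminal {x : C.Trajectory} (hx : x.1 ∈ C.terminals) :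
    C.index x = C.surrogate x := by
  have : {w : ℝ | ∃ z : C.Trajectory, C.Extends x z ∧ z.1 ∈ C.terminals ∧ w = C.surrogate z} =
      {C.surrogate x} := by
    ext w
    simp only [Set.mem_ofPred_eq, Set.mem_singleton_iff]
    constructor
    · rintro ⟨z, hz, -, rfl⟩
      rw [hz.eq_of_terminal hx]
    · rintro rfl
      exact ⟨x, .refl, hx, rfl⟩
  rw [index, this, csSup_singleton]

/-- Truncations only accumulate along an extension. The terminal extension `z` excludes the supremum
of the empty set, which would be the default value `0`. -/
theorem index_le_of_terminal_extends {x z : C.Trajectory} (h : C.Extends x z)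
    (hz : z.1 ∈ C.terminals) : C.index x ≤ C.surrogate x :=
  csSup_le ⟨_, z, h, hz, rfl⟩ (by rintro w ⟨z', hz', -, rfl⟩; exact hz'.surrogate_le)

/-- A step to a terminal state whose level is at least that of its predecessor does not decrease
the index. -/
theorem index_le_index_of_step {r s : Fin C.numStates} {l : List (Fin C.numStates)}
    (hs : s ∉ C.terminals) (hr : r ∈ C.terminals) (hpos : 0 < C.trans s r)
    (hlevel : C.level s ≤ C.level r) : C.index (s, l) ≤ C.index (r, s :: l) := by
  refine (index_le_of_terminal_extends (.step .refl hs hpos) hr).trans ?_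
  rw [index_of_terminal (x := (r, s :: l)) hr, surrogate_cons]
  -- The surrogate value of `(s, l)` already includes the truncation at `s`, so it is at most the
  -- level of `s`.
  refine le_min (le_trans ?_ hlevel) le_rfl
  cases l with
  | nil => exact le_rfl
  | cons a l => rw [surrogate_cons]; exact min_le_left _ _

end MarkovChain

/-! ## Histories of the revealing chains -/

/-- The revealing chains of a product distribution. -/
noncomputable abbrev chains {n : ℕ} (D : Fin n → Distribution) (i : Fin n) : MarkovChain :=
  (D i).chain

/-- Every trajectory of the history can occur. -/
def History.Reachable {n : ℕ} {M : Fin n → MarkovChain} (h : History M) : Prop :=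
  ∀ i, h i = ((M i).root, []) ∨ ∃ s l, (h i).2 = s :: l ∧ s ∉ (M i).terminals ∧
    0 < (M i).trans s (h i).1

/-- The chains that have reached a terminal state. -/
def History.finished {n : ℕ} {M : Fin n → MarkovChain} (h : History M) : Finset (Fin n) :=
  Finset.univ.filter fun i => (h i).1 ∈ (M i).terminals

section

variable {n : ℕ} {M : Fin n → MarkovChain} {h : History M}

theorem History.mem_finished {i : Fin n} : i ∈ h.finished ↔ (h i).1 ∈ (M i).terminals := by
  simp [History.finished]

theorem History.move_same (i : Fin n) (r : Fin (M i).numStates) :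
    h.move i r i = (r, (h i).1 :: (h i).2) := by simp [History.move]

theorem History.move_ne {i j : Fin n} (hj : j ≠ i) (r : Fin (M i).numStates) :
    h.move i r j = h j := by simp [History.move, hj]

theorem History.reachable_init : (History.init M).Reachable := fun _ => Or.inl rfl

theorem History.Reachable.move (hh : h.Reachable) {i : Fin n} {r : Fin (M i).numStates}
    (hi : (h i).1 ∉ (M i).terminals) (hr : 0 < (M i).trans (h i).1 r) :
    (h.move i r).Reachable := by
  intro j
  by_cases hj : j = i
  · subst hj
    rw [move_same]
    exact Or.inr ⟨_, _, rfl, hi, hr⟩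
  · rw [move_ne hj]; exact hh j

theorem History.finished_move_terminal {i : Fin n} {r : Fin (M i).numStates}
    (hr : r ∈ (M i).terminals) : (h.move i r).finished = insert i h.finished := by
  ext j
  by_cases hj : j = i
  · subst hj; simp [mem_finished, move_same, hr]
  · simp [mem_finished, move_ne hj, hj]

theorem History.finished_move_nonterminal {i : Fin n} {r : Fin (M i).numStates}
    (hi : (h i).1 ∉ (M i).terminals) (hr : r ∉ (M i).terminals) :
    (h.move i r).finished = h.finished := by
  ext j
  by_cases hj : j = i
  · subst hj; simp [mem_finished, move_same, hr, hi]
  · simp [mem_finished, move_ne hj]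

theorem History.finished_subset_move {i : Fin n} {r : Fin (M i).numStates}
    (hi : (h i).1 ∉ (M i).terminals) : h.finished ⊆ (h.move i r).finished := by
  intro j hj
  have : j ≠ i := by rintro rfl; exact hi (mem_finished.1 hj)
  rw [mem_finished] at *
  rwa [move_ne this]

end

/-- The semi-online algorithm that simulates a policy on the revealing chains: advancing the chain
`i` becomes a threshold test of the element `i`. -/
noncomputable def Policy.toSemiOnline {n : ℕ} {D : Fin n → Distribution} :
    Policy (chains D) → History (chains D) → SemiOnline n
  | .halt _, _ => .halt
  | .advance i next, h =>
      .probe i ((D i).pointNat ((h i).1 / 2))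
        ((next (Distribution.yes (h i).1)).toSemiOnline (h.move i (Distribution.yes (h i).1)))
        ((next (Distribution.no (h i).1)).toSemiOnline (h.move i (Distribution.no (h i).1)))
  | .toss next, h => .toss fun b => (next b).toSemiOnline h

/-! ### From promise of payment to legality of the simulated algorithm. -/

section

variable {n : ℕ} {D : Fin n → Distribution} {F : Constraint n} {coins : Bool}

open CICS.Distribution

/-- When a policy with promise of payment halts, it selects exactly the finished chains. -/
theorem Policy.selected_eq_finished {S : Finset (Fin n)} {h : History (chains D)}
    (hv : (Policy.halt S : Policy (chains D)).ValidFrom F coins h)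
    (hp : (Policy.halt S : Policy (chains D)).PromiseFrom h) (hh : h.Reachable) :
    S = h.finished := by
  ext i
  rw [History.mem_finished]
  refine ⟨hv.2 i, fun hi => ?_⟩
  rcases hh i with h0 | ⟨s, l, hl, hs, hpos⟩
  · rw [h0] at hi
    exact absurd hi (root_notMem_terminals _)
  · rcases hp i with hS | h0 | ⟨s', l', hl', hlt⟩
    · exact hS
    · rw [hl] at h0; exact absurd h0 (List.cons_ne_nil _ _)
    · rw [hl] at hl'
      obtain ⟨rfl, rfl⟩ := List.cons.inj hl'
      have e : h i = ((h i).1, s :: l) := by rw [← hl]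
      -- A terminal state is entered only by a successful test, which preserves the level; hence the
      -- index cannot have dropped in the last step.
      refine absurd hlt (not_lt.2 ?_)
      rw [e]
      refine MarkovChain.index_le_index_of_step hs hi hpos ?_
      rw [level_eq, level_eq, eq_yes_of_trans_pos hs hi hpos, yes_half hs]

/-- Along an execution in which every test succeeds, finished chains only accumulate until the
policy halts and selects all of them; downward closure does the rest. -/
theorem Policy.finished_mem {π : Policy (chains D)} {h : History (chains D)}
    (hv : π.ValidFrom F coins h) (hp : π.PromiseFrom h) (hh : h.Reachable) :
    h.finished ∈ F.sets := by
  induction π generalizing h with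
  | halt S =>
    rw [← Policy.selected_eq_finished hv hp hh]
    exact hv.1
  | advance i next ih =>
    have hpos := trans_yes_pos hv.1
    exact F.down_closed _ (ih _ (hv.2 _ hpos) (hp _ hpos) (hh.move hv.1 hpos)) _
      (History.finished_subset_move hv.1)
  | toss next ih => exact ih true (hv.2 _) (hp _) hh

/-- Inclusion, and not equality, is the right invariant: in the impossible failure branch at state
`1` the chain moves to the terminal state `0` although its element has not been accepted. -/
theorem Policy.toSemiOnline_validFrom {π : Policy (chains D)} {h : History (chains D)}
    (hv : π.ValidFrom F coins h) (hp : π.PromiseFrom h) (hh : h.Reachable)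
    {S : Finset (Fin n)} (hS : S ⊆ h.finished) :
    (π.toSemiOnline h).ValidFrom F coins S := by
  induction π generalizing h S with
  | halt _ => trivial
  | advance i next ih =>
    have hyes := trans_yes_pos hv.1
    have hno := trans_no_pos hv.1
    have hins : insert i S ⊆ (h.move i (yes (h i).1)).finished := by
      rw [History.finished_move_terminal (yes_mem_terminals hv.1)]
      exact Finset.insert_subset_insert i hS
    refine ⟨fun hi => hv.1 (History.mem_finished.1 (hS hi)), ?_, ?_, ?_⟩
    · exact F.down_closed _
        (finished_mem (hv.2 _ hyes) (hp _ hyes) (hh.move hv.1 hyes)) _ hins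
    · exact ih _ (hv.2 _ hyes) (hp _ hyes) (hh.move hv.1 hyes) hins
    · exact ih _ (hv.2 _ hno) (hp _ hno) (hh.move hv.1 hno)
        (hS.trans (History.finished_subset_move hv.1))
  | toss next ih => exact ⟨hv.1, fun b => ih b (hv.2 b) (hp b) hh hS⟩

/-! ## Conditional means -/

/-- The distribution of a draw given that the revealing chain is in the state `s`. -/
noncomputable def Distribution.law (D : Distribution) (s : Fin D.chain.numStates)
    (j : Fin D.supportSize) : ℝ :=
  if (s : ℕ) % 2 = 0 then (if (j : ℕ) = s / 2 then 1 else 0)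
  else if (j : ℕ) ≤ s / 2 then D.prob j / D.cumulative (s / 2 + 1) else 0

theorem Distribution.law_terminal {D : Distribution} {s : Fin D.chain.numStates}
    (hs : s ∈ D.chain.terminals) (j : Fin D.supportSize) :
    D.law s j = if (j : ℕ) = s / 2 then 1 else 0 := if_pos (D.mem_terminals.1 hs)

theorem Distribution.law_nonterminal {D : Distribution} {s : Fin D.chain.numStates}
    (hs : s ∉ D.chain.terminals) (j : Fin D.supportSize) :
    D.law s j = if (j : ℕ) ≤ s / 2 then D.prob j / D.cumulative (s / 2 + 1) else 0 :=
  if_neg fun h => hs (D.mem_terminals.2 h)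

/-- Bayes' rule for one test: success isolates the top point, failure conditions on the points below
it, and the factors `cumulative (s / 2)` cancel. -/
theorem Distribution.sum_trans_law {D : Distribution} {s : Fin D.chain.numStates}
    (hs : s ∉ D.chain.terminals) (j : Fin D.supportSize) :
    ∑ r, D.chain.trans s r * D.law r j = D.law s j := by
  rw [sum_trans hs, law_nonterminal hs, law_terminal (yes_mem_terminals hs), yes_half hs]
  have hs' := hs
  rw [mem_terminals] at hs'
  have hc := D.cumulative_succ_pos (s / 2)
  by_cases h1 : (s : ℕ) = 1
  · simp only [h1, D.cumulative_zero, Nat.reduceDiv, zero_div, zero_mul, add_zero]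
    split_ifs with h2 h3 h3
    · rw [← D.probNat_fin, h2, mul_one]
    · omega
    · omega
    · rw [mul_zero]
  · have hn : no s ∉ D.chain.terminals := by rw [mem_terminals]; simp only [no]; omega
    have hhalf : (no s : ℕ) / 2 + 1 = s / 2 := by simp only [no]; omega
    have hc' : 0 < D.cumulative (s / 2) := cumulative_pos (by omega)
    rw [law_nonterminal hn, hhalf]
    rcases lt_trichotomy (j : ℕ) (s / 2) with h | h | h
    · rw [if_neg h.ne, if_pos (by omega), if_pos h.le]
      field_simp; ring
    · rw [if_pos h, if_neg (by omega), if_pos h.le, ← D.probNat_fin, h]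
      ring
    · rw [if_neg h.ne', if_neg (by omega), if_neg (by omega)]
      ring

theorem Distribution.law_root (D : Distribution) : D.law D.chain.root = D.prob := by
  have := D.supportSize_pos
  ext j
  have hj := j.2
  have e : (2 * D.supportSize - 1) / 2 + 1 = D.supportSize := by omega
  rw [law_nonterminal D.root_notMem_terminals, chain_root, e, cumulative_supportSize,
    if_pos (by omega), div_one]

theorem Distribution.sum_law (D : Distribution) (s : Fin D.chain.numStates) :
    ∑ j, D.law s j = 1 := by
  induction s using WellFoundedLT.induction with
  | _ s ih =>
  by_cases hs : s ∈ D.chain.terminals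
  · rw [Fintype.sum_eq_single ⟨s / 2, D.half_lt s⟩]
    · rw [law_terminal hs, if_pos rfl]
    · intro j hj
      rw [law_terminal hs, if_neg fun h => hj (Fin.ext h)]
  · simp_rw [← sum_trans_law hs]
    rw [Finset.sum_comm, ← D.chain.trans_sum s hs]
    refine Finset.sum_congr rfl fun r _ => ?_
    rw [← Finset.mul_sum]
    rcases (D.chain.trans_nonneg s hs r).eq_or_lt with h | h
    · rw [← h, zero_mul]
    · rw [ih r (D.chain.trans_lt s hs r h), mul_one]

/-- The mean of `f x` given the history of the revealing chains. -/
noncomputable def History.mean (h : History (chains D)) (f : (Fin n → ℝ) → ℝ) : ℝ :=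
  ∑ ω : (i : Fin n) → Fin (D i).supportSize,
    (∏ i, (D i).law (h i).1 (ω i)) * f (fun i => (D i).point (ω i))

theorem History.mean_init (f : (Fin n → ℝ) → ℝ) :
    (History.init (chains D)).mean f = expect D f := by
  simp only [History.mean, History.init, law_root, expect]

/-- The tower property: a move changes only the `i`-th factor of the product law, and that factor
averages back by `sum_trans_law`. -/
theorem History.mean_move (h : History (chains D)) {i : Fin n}
    (hi : (h i).1 ∉ (D i).chain.terminals) (f : (Fin n → ℝ) → ℝ) :
    ∑ r, (D i).chain.trans (h i).1 r * (h.move i r).mean f = h.mean f := by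
  simp only [History.mean, Finset.mul_sum]
  rw [Finset.sum_comm]
  refine Finset.sum_congr rfl fun ω _ => ?_
  have key : ∀ r, ∏ j, (D j).law ((h.move i r) j).1 (ω j) =
      (D i).law r (ω i) * ∏ j ∈ Finset.univ.erase i, (D j).law (h j).1 (ω j) := by
    intro r
    rw [← Finset.mul_prod_erase _ _ (Finset.mem_univ i), move_same]
    congr 1
    refine Finset.prod_congr rfl fun j hj => ?_
    rw [move_ne (Finset.ne_of_mem_erase hj)]
  simp_rw [key]
  rw [← Finset.mul_prod_erase _ _ (Finset.mem_univ i), ← sum_trans_law hi, Finset.sum_mul,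
    Finset.sum_mul]
  refine Finset.sum_congr rfl fun r _ => ?_
  ring

theorem History.mean_congr (h : History (chains D)) {f g : (Fin n → ℝ) → ℝ}
    (hfg : ∀ ω : (i : Fin n) → Fin (D i).supportSize, (∀ i, (D i).law (h i).1 (ω i) ≠ 0) →
      f (fun i => (D i).point (ω i)) = g (fun i => (D i).point (ω i))) :
    h.mean f = h.mean g := by
  refine Finset.sum_congr rfl fun ω _ => ?_
  by_cases hω : ∏ i, (D i).law (h i).1 (ω i) = 0
  · rw [hω, zero_mul, zero_mul]
  · rw [hfg ω fun i hi => hω (Finset.prod_eq_zero (Finset.mem_univ i) hi)]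

theorem History.mean_const (h : History (chains D)) (c : ℝ) : h.mean (fun _ => c) = c := by
  rw [History.mean, ← Finset.sum_mul, ← Fintype.prod_sum]
  simp [sum_law]

theorem History.mean_add (h : History (chains D)) (f g : (Fin n → ℝ) → ℝ) :
    h.mean (fun x => f x + g x) = h.mean f + h.mean g := by
  simp only [History.mean, mul_add, Finset.sum_add_distrib]

theorem History.mean_div (h : History (chains D)) (f : (Fin n → ℝ) → ℝ) (c : ℝ) :
    h.mean (fun x => f x / c) = h.mean f / c := by
  simp only [History.mean, Finset.sum_div, mul_div_assoc]

/-! ## Utility equals value -/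

/-- When the policy halts, the selected chains are the finished ones and no gain is left. A
successful test turns the threshold from future gain into the value of a finished chain, and a
failed one changes neither the committed value nor the gain collected so far. -/
theorem Policy.utilityFrom_eq {π : Policy (chains D)} {h : History (chains D)}
    (hv : π.ValidFrom F coins h) (hp : π.PromiseFrom h) (hh : h.Reachable) :
    π.utilityFrom h = ∑ i ∈ h.finished, (D i).chain.value (h i).1 +
      h.mean fun x => (π.toSemiOnline h).gain x := by
  induction π generalizing h with
  | halt S =>
    rw [← Policy.selected_eq_finished hv hp hh]
    simp [utilityFrom, toSemiOnline, SemiOnline.gain, History.mean_const]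
  | advance i next ih =>
    have hi : (h i).1 ∉ (D i).chain.terminals := hv.1
    have hyes := trans_yes_pos hi
    have hno := trans_no_pos hi
    have ihyes := ih _ (hv.2 _ hyes) (hp _ hyes) (hh.move hi hyes)
    have ihno := ih _ (hv.2 _ hno) (hp _ hno) (hh.move hi hno)
    have hcost : (D i).chain.cost (h i).1 = 0 := rfl
    have hvalue : ∀ r, ∑ j ∈ h.finished, (D j).chain.value ((h.move i r) j).1 =
        ∑ j ∈ h.finished, (D j).chain.value (h j).1 := by
      refine fun r => Finset.sum_congr rfl fun j hj => ?_
      rw [History.move_ne]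
      rintro rfl
      exact hi (History.mem_finished.1 hj)
    -- After a success the law of the element is the point mass at the threshold itself, so the
    -- probe accepts and collects exactly this value.
    have hmeanyes : (h.move i (yes (h i).1)).mean
        (fun x => ((Policy.advance i next).toSemiOnline h).gain x) =
        (D i).pointNat ((h i).1 / 2) + (h.move i (yes (h i).1)).mean fun x =>
          ((next (yes (h i).1)).toSemiOnline (h.move i (yes (h i).1))).gain x := by
      conv_rhs => rw [← History.mean_const (h.move i (yes (h i).1)) ((D i).pointNat _),
        ← History.mean_add]
      refine History.mean_congr _ fun ω hω => ?_
      have := hω i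
      rw [History.move_same, law_terminal (yes_mem_terminals hi), yes_half hi] at this
      have e : (D i).point (ω i) = (D i).pointNat ((h i).1 / 2) := by
        by_contra hne
        exact this (if_neg fun h' => hne (by rw [← h', pointNat_fin]))
      simp only [toSemiOnline, SemiOnline.gain, e, le_refl, if_true]
    -- After a failure only values strictly below the threshold remain. At state `1` this is false
    -- since `no` coincides with `yes`, but there the failure weight is `0`.
    have hmeanno : (h i).1.val ≠ 1 → (h.move i (no (h i).1)).mean
        (fun x => ((Policy.advance i next).toSemiOnline h).gain x) =
        (h.move i (no (h i).1)).mean fun x =>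
          ((next (no (h i).1)).toSemiOnline (h.move i (no (h i).1))).gain x := by
      intro h1
      have hi' := hi
      rw [mem_terminals] at hi'
      refine History.mean_congr _ fun ω hω => ?_
      have := hω i
      have hn : no (h i).1 ∉ (D i).chain.terminals := by
        rw [mem_terminals]; simp only [no]; omega
      rw [History.move_same, law_nonterminal hn] at this
      have e : (D i).point (ω i) < (D i).pointNat ((h i).1 / 2) := by
        rw [← pointNat_fin]
        refine pointNat_lt _ ?_ (half_lt _ _)
        by_contra hne
        refine this (if_neg ?_)
        simp only [no]; omega
      simp only [toSemiOnline, SemiOnline.gain, e.not_ge, if_false]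
    have hsum := transition_weights_add (D i) ((h i).1 / 2)
    rw [utilityFrom, hcost, sum_trans hi, ← History.mean_move h hi, sum_trans hi, ihyes, hmeanyes,
      History.finished_move_terminal (yes_mem_terminals hi), Finset.sum_insert, hvalue,
      History.move_same]
    · have hv : (D i).chain.value (yes (h i).1) = (D i).pointNat ((h i).1 / 2) := by
        change (D i).pointNat ((yes (h i).1 : ℕ) / 2) = _
        rw [yes_half hi]
      simp only [hv]
      by_cases h1 : ((h i).1 : ℕ) = 1
      · rw [h1] at hsum ⊢
        simp only [Nat.reduceDiv, cumulative_zero, zero_div, add_zero] at hsum ⊢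
        rw [hsum]; ring
      · have hn : no (h i).1 ∉ (D i).chain.terminals := by
          rw [mem_terminals] at *; simp only [no]; omega
        rw [ihno, hmeanno h1, History.finished_move_nonterminal hi hn, hvalue]
        linear_combination (∑ j ∈ h.finished, (D j).chain.value (h j).1) * hsum
    · rw [History.mem_finished]; exact hi
  | toss next ih =>
    rw [utilityFrom, ih true (hv.2 _) (hp _) hh, ih false (hv.2 _) (hp _) hh]
    simp only [toSemiOnline, SemiOnline.gain]
    rw [History.mean_div, History.mean_add]
    ring

/-! ## The ex post optimum as the utility of a policy -/

/-- The policy reveals every draw at no cost and only then picks a set, so it does so knowing `x`.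
The sum of the state numbers decreases with each possible transition and drives the induction. -/
theorem Policy.exists_mean_le (f : (Fin n → ℝ) → ℝ)
    (hf : ∀ x, ∃ S ∈ F.sets, f x ≤ ∑ i ∈ S, x i) (h : History (chains D)) :
    ∃ π : Policy (chains D), π.ValidFrom F true h ∧ h.mean f ≤ π.utilityFrom h := by
  induction hm : ∑ i, ((h i).1 : ℕ) using Nat.strong_induction_on generalizing h with
  | _ m ih =>
  by_cases hall : ∀ i, (h i).1 ∈ (D i).chain.terminals
  · obtain ⟨S, hS, hle⟩ := hf fun i => (D i).chain.value (h i).1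
    refine ⟨.halt S, ⟨hS, fun i _ => hall i⟩, ?_⟩
    refine le_of_eq_of_le ?_ hle
    rw [← History.mean_const h (f _)]
    refine History.mean_congr _ fun ω hω => ?_
    congr 1
    ext i
    have := hω i
    rw [law_terminal (hall i)] at this
    by_contra hne
    refine this (if_neg fun h' => hne ?_)
    change _ = (D i).pointNat ((h i).1 / 2)
    rw [← h', pointNat_fin]
  · push Not at hall
    obtain ⟨i, hi⟩ := hall
    have step : ∀ r, ∃ π : Policy (chains D), 0 < (D i).chain.trans (h i).1 r →
        π.ValidFrom F true (h.move i r) ∧ (h.move i r).mean f ≤ π.utilityFrom (h.move i r) := by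
      intro r
      by_cases hr : 0 < (D i).chain.trans (h i).1 r
      · obtain ⟨π, hπ⟩ := ih _ (by
          rw [← hm]
          refine Finset.sum_lt_sum (fun j _ => ?_) ⟨i, Finset.mem_univ i, ?_⟩
          · by_cases hj : j = i
            · subst hj
              rw [History.move_same]
              exact (Fin.lt_def.1 ((D j).chain.trans_lt _ hi _ hr)).le
            · rw [History.move_ne hj]
          · rw [History.move_same]
            exact Fin.lt_def.1 ((D i).chain.trans_lt _ hi _ hr)) (h.move i r) rfl
        exact ⟨π, fun _ => hπ⟩
      · exact ⟨.halt ∅, fun h' => absurd h' hr⟩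
    choose next hnext using step
    refine ⟨.advance i next, ⟨hi, fun r hr => (hnext r hr).1⟩, ?_⟩
    have hcost : (D i).chain.cost (h i).1 = 0 := rfl
    rw [utilityFrom, hcost, ← History.mean_move h hi, neg_zero, zero_add]
    refine Finset.sum_le_sum fun r _ => ?_
    rcases ((D i).chain.trans_nonneg _ hi r).eq_or_lt with h0 | hr
    · rw [← h0, zero_mul, zero_mul]
    · exact mul_le_mul_of_nonneg_left (hnext r hr).2 hr.le

/-- Costs only lower the utility. The bound is what makes the supremum in `opt` a true one: over an
unbounded set `sSup` would return `0`. -/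
theorem Policy.utilityFrom_le {M : Fin n → MarkovChain} {π : Policy M} {h : History M}
    (hv : π.ValidFrom F coins h) : π.utilityFrom h ≤ ∑ i, ∑ s, |(M i).value s| := by
  induction π generalizing h with
  | halt S =>
    refine (Finset.sum_le_sum fun i _ => le_abs_self _).trans
      ((Finset.sum_le_univ_sum_of_nonneg fun i => abs_nonneg _).trans
        (Finset.sum_le_sum fun i _ => ?_))
    exact Finset.single_le_sum (f := fun s => |(M i).value s|) (fun _ _ => abs_nonneg _)
      (Finset.mem_univ _)
  | advance i next ih =>
    have hc := (M i).cost_nonneg _ hv.1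
    have : ∑ r, (M i).trans (h i).1 r * (next r).utilityFrom (h.move i r) ≤
        ∑ r, (M i).trans (h i).1 r * ∑ i, ∑ s, |(M i).value s| := by
      refine Finset.sum_le_sum fun r _ => ?_
      rcases ((M i).trans_nonneg _ hv.1 r).eq_or_lt with h0 | hr
      · rw [← h0, zero_mul, zero_mul]
      · exact mul_le_mul_of_nonneg_left (ih r (hv.2 r hr)) hr.le
    rw [← Finset.sum_mul, (M i).trans_sum _ hv.1, one_mul] at this
    rw [utilityFrom]
    linarith
  | toss next ih =>
    have h1 := ih true (hv.2 _)
    have h2 := ih false (hv.2 _)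
    rw [utilityFrom]
    linarith

theorem exPost_le_opt (F : Constraint n) (D : Fin n → Distribution) :
    exPost F D ≤ opt F (chains D) := by
  obtain ⟨π, hv, hle⟩ := Policy.exists_mean_le (F := F)
    (fun x => F.sets.sup' ⟨∅, F.empty_mem⟩ fun S => ∑ i ∈ S, x i)
    (fun x => by
      obtain ⟨S, hS, e⟩ := Finset.exists_mem_eq_sup' ⟨∅, F.empty_mem⟩ fun S => ∑ i ∈ S, x i
      exact ⟨S, hS, e.le⟩) (History.init (chains D))
  rw [History.mean_init] at hle
  refine hle.trans (le_csSup ⟨∑ i, ∑ s, |(chains D i).value s|, ?_⟩ ⟨π, hv, rfl⟩)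
  rintro u ⟨π', hv', rfl⟩
  exact Policy.utilityFrom_le hv'

theorem exPost_nonneg (F : Constraint n) (D : Fin n → Distribution) : 0 ≤ exPost F D := by
  refine Finset.sum_nonneg fun ω _ => mul_nonneg
    (Finset.prod_nonneg fun i _ => ((D i).prob_pos _).le) ?_
  exact (Finset.le_sup' (fun S => ∑ i ∈ S, (D i).point (ω i)) F.empty_mem).trans' (by simp)

theorem Policy.utility_eq_val {π : Policy (chains D)} (hv : π.Valid F coins)
    (hp : π.PromiseOfPayment) :
    π.utility = (π.toSemiOnline (History.init _)).val D := by
  rw [utility, utilityFrom_eq hv hp History.reachable_init, History.mean_init, SemiOnline.val]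
  have : (History.init (chains D)).finished = ∅ := by
    ext i
    simp only [History.mem_finished, Finset.notMem_empty, iff_false]
    exact root_notMem_terminals _
  rw [this, Finset.sum_empty, zero_add]

end

end CICS

namespace CICS

/-! ## Running times of programs -/

/-- The program `p` on input `x` halts with output `z` after at most `t` steps. -/
def Prog.Computes (p : Prog) (x z : Data) (t : ℕ) : Prop := ∃ u ≤ t, Exec p x z u

/-- The output of a program without loops (and `none` where it blocks or reaches a loop). -/
noncomputable def Prog.eval : Prog → Data → Option Data
  | .id, x => some x
  | .nil, _ => some .nil
  | .const q, _ => some (.num (q : ℝ))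
  | .fst, .cons a _ => some a
  | .snd, .cons _ b => some b
  | .add, .cons (.num a) (.num b) => some (.num (a + b))
  | .sub, .cons (.num a) (.num b) => some (.num (a - b))
  | .mul, .cons (.num a) (.num b) => some (.num (a * b))
  | .div, .cons (.num a) (.num b) => open Classical in if b = 0 then none else some (.num (a / b))
  | .lt, .cons (.num a) (.num b) => open Classical in if a < b then some (.num 1) else some .nil
  | .isCons, .cons _ _ => some (.num 1)
  | .isCons, _ => some .nil
  | .pair p q, x => (p.eval x).bind fun y => (q.eval x).bind fun z => some (.cons y z)
  | .comp p q, x => (p.eval x).bind q.eval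
  | .ite c p q, x => (c.eval x).bind fun y =>
      match y with
      | .nil => q.eval x
      | .num _ => p.eval x
      | .cons _ _ => p.eval x
  | _, _ => none

/-- A bound on the running time of a program without loops. -/
def Prog.weight : Prog → ℕ
  | .pair p q => p.weight + q.weight + 1
  | .comp p q => p.weight + q.weight + 1
  | .ite c p q => c.weight + p.weight + q.weight + 1
  | _ => 1

namespace Prog

variable {p q c : Prog} {x y z w : Data} {t u v : ℕ}

theorem Computes.mono (h : p.Computes x z t) (htu : t ≤ u) : p.Computes x z u :=
  h.imp fun _ ⟨h1, h2⟩ => ⟨h1.trans htu, h2⟩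

theorem Computes.comp (h1 : p.Computes x y t) (h2 : q.Computes y z u) :
    (Prog.comp p q).Computes x z (t + u + 1) := by
  obtain ⟨a, ha, h1⟩ := h1
  obtain ⟨b, hb, h2⟩ := h2
  exact ⟨_, by omega, h1.comp h2⟩

theorem Computes.pair (h1 : p.Computes x y t) (h2 : q.Computes x z u) :
    (Prog.pair p q).Computes x (.cons y z) (t + u + 1) := by
  obtain ⟨a, ha, h1⟩ := h1
  obtain ⟨b, hb, h2⟩ := h2
  exact ⟨_, by omega, h1.pair h2⟩

theorem Computes.ite_true (h1 : c.Computes x y t) (hy : y ≠ .nil) (h2 : p.Computes x z u) :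
    (Prog.ite c p q).Computes x z (t + u + 1) := by
  obtain ⟨a, ha, h1⟩ := h1
  obtain ⟨b, hb, h2⟩ := h2
  exact ⟨_, by omega, h1.ite_true hy h2⟩

theorem Computes.ite_false (h1 : c.Computes x .nil t) (h2 : q.Computes x z u) :
    (Prog.ite c p q).Computes x z (t + u + 1) := by
  obtain ⟨a, ha, h1⟩ := h1
  obtain ⟨b, hb, h2⟩ := h2
  exact ⟨_, by omega, h1.ite_false h2⟩

/-- Correctness and running time of straight-line code reduce to evaluating `eval`, which `simp` can
do; induction is left for the loops. -/
theorem computes_of_eval (h : p.eval x = some z) : p.Computes x z p.weight := by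
  induction p generalizing x z with
  | id => simp only [eval, Option.some.injEq] at h; subst h; exact ⟨1, le_rfl, .id _⟩
  | nil => simp only [eval, Option.some.injEq] at h; subst h; exact ⟨1, le_rfl, .nil _⟩
  | const q => simp only [eval, Option.some.injEq] at h; subst h; exact ⟨1, le_rfl, .const _ _⟩
  | fst =>
    cases x <;> simp only [eval, Option.some.injEq, reduceCtorEq] at h
    subst h; exact ⟨1, le_rfl, .fst _ _⟩
  | snd =>
    cases x <;> simp only [eval, Option.some.injEq, reduceCtorEq] at h
    subst h; exact ⟨1, le_rfl, .snd _ _⟩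
  | add =>
    unfold eval at h; split at h <;> simp_all only [Option.some.injEq, reduceCtorEq]
    all_goals subst h; exact ⟨1, le_rfl, .add _ _⟩
  | sub =>
    unfold eval at h; split at h <;> simp_all only [Option.some.injEq, reduceCtorEq]
    all_goals subst h; exact ⟨1, le_rfl, .sub _ _⟩
  | mul =>
    unfold eval at h; split at h <;> simp_all only [Option.some.injEq, reduceCtorEq]
    all_goals subst h; exact ⟨1, le_rfl, .mul _ _⟩
  | div =>
    unfold eval at h; split at h <;> simp_all only [reduceCtorEq]
    split_ifs at h with hb
    simp only [Option.some.injEq] at h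
    subst h; exact ⟨1, le_rfl, .div _ _ hb⟩
  | lt =>
    unfold eval at h; split at h <;> simp_all only [reduceCtorEq]
    split_ifs at h with hb <;> simp only [Option.some.injEq] at h <;> subst h
    · exact ⟨1, le_rfl, .lt_true _ _ hb⟩
    · exact ⟨1, le_rfl, .lt_false _ _ hb⟩
  | isCons =>
    cases x <;> simp only [eval, Option.some.injEq] at h <;> subst h
    · exact ⟨1, le_rfl, .isCons_nil⟩
    · exact ⟨1, le_rfl, .isCons_num _⟩
    · exact ⟨1, le_rfl, .isCons_cons _ _⟩
  | pair p q ihp ihq =>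
    simp only [eval, Option.bind_eq_some_iff, Option.some.injEq] at h
    obtain ⟨y, hy, z, hz, rfl⟩ := h
    exact (ihp hy).pair (ihq hz)
  | comp p q ihp ihq =>
    simp only [eval, Option.bind_eq_some_iff] at h
    obtain ⟨y, hy, hz⟩ := h
    exact (ihp hy).comp (ihq hz)
  | ite c p q ihc ihp ihq =>
    simp only [eval, Option.bind_eq_some_iff] at h
    obtain ⟨y, hy, hz⟩ := h
    cases y with
    | nil => exact ((ihc hy).ite_false (ihq hz)).mono (by simp only [weight]; omega)
    | num a =>
      exact ((ihc hy).ite_true (by simp) (ihp hz)).mono (by simp only [weight]; omega)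
    | cons a b =>
      exact ((ihc hy).ite_true (by simp) (ihp hz)).mono (by simp only [weight]; omega)
  | loop c p => simp [eval] at h

theorem computes_loop_exit (h : c.eval x = some .nil) :
    (loop c p).Computes x x (c.weight + 1) := by
  obtain ⟨a, ha, h⟩ := computes_of_eval h
  exact ⟨_, by omega, Exec.loop_stop h⟩

theorem Computes.loop_step (h1 : c.eval x = some y) (hy : y ≠ .nil) (h2 : p.Computes x z u)
    (h3 : (loop c p).Computes z w v) : (loop c p).Computes x w (c.weight + u + v + 1) := by
  obtain ⟨a, ha, h1⟩ := computes_of_eval h1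
  obtain ⟨b, hb, h2⟩ := h2
  obtain ⟨d, hd, h3⟩ := h3
  exact ⟨_, by omega, h1.loop_step hy h2 h3⟩

/-- This allows the overhead of a simulated round to be charged to the steps of that round. -/
theorem one_le_of_exec (h : Exec p x z t) : 1 ≤ t := by cases h <;> omega

end Prog

/-! ## List programs -/

open Data Prog

theorem ofList_nil : ofList [] = .nil := rfl

theorem ofList_cons (a : Data) (l : List Data) : ofList (a :: l) = .cons a (ofList l) := rfl

namespace Prog

/-- Maps a pair of lists `l` and `m` to the pair of `[]` and `l.reverse ++ m`. -/
def reverseOnto : Prog :=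
  loop (comp fst isCons) (pair (comp fst snd) (pair (comp fst fst) snd))

theorem computes_reverseOnto (l m : List Data) :
    reverseOnto.Computes (cons (ofList l) (ofList m)) (cons .nil (ofList (l.reverse ++ m)))
      (13 * l.length + 4) := by
  induction l generalizing m with
  | nil => exact computes_loop_exit (by simp [eval, ofList_nil])
  | cons a l ih =>
    have h := Computes.loop_step (c := comp fst isCons) (y := .num 1)
      (x := cons (ofList (a :: l)) (ofList m)) (by simp [eval, ofList_cons]) (by simp)
      (computes_of_eval (p := pair (comp fst snd) (pair (comp fst fst) snd))
        (z := cons (ofList l) (ofList (a :: m))) (by simp [eval, ofList_cons]))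
      (ih (a :: m))
    rw [List.reverse_cons, List.append_assoc, List.singleton_append]
    refine h.mono ?_
    simp only [weight, List.length_cons]
    omega

/-- Maps `(l, m, i)` with lists `l` and `m` to `(l.drop i, (l.take i).reverse ++ m, 0)`. -/
def unzipTo : Prog :=
  loop (comp (pair (const 0) (comp snd snd)) lt)
    (pair (comp fst snd) (pair (pair (comp fst fst) (comp snd fst))
      (comp (pair (comp snd snd) (const 1)) sub)))

theorem computes_unzipTo (l r m : List Data) :
    unzipTo.Computes (cons (ofList (l ++ r)) (cons (ofList m) (num (l.length : ℕ))))
      (cons (ofList r) (cons (ofList (l.reverse ++ m)) (num 0))) (27 * l.length + 10) := by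
  induction l generalizing m with
  | nil =>
    have h := computes_loop_exit (c := comp (pair (const 0) (comp snd snd)) lt)
      (p := pair (comp fst snd) (pair (pair (comp fst fst) (comp snd fst))
        (comp (pair (comp snd snd) (const 1)) sub)))
      (x := cons (ofList r) (cons (ofList m) (num 0))) (by simp [eval])
    simp only [List.length_nil, Nat.cast_zero, List.nil_append, List.reverse_nil]
    refine h.mono ?_
    simp [weight]
  | cons a l ih =>
    have hpos : (0 : ℝ) < (l.length : ℝ) + 1 := by positivity
    have h := Computes.loop_step (c := comp (pair (const 0) (comp snd snd)) lt) (y := .num 1)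
      (x := cons (ofList (a :: l ++ r)) (cons (ofList m) (num ((a :: l).length : ℕ))))
      (by simp [eval, hpos]) (by simp)
      (computes_of_eval (p := pair (comp fst snd) (pair (pair (comp fst fst) (comp snd fst))
          (comp (pair (comp snd snd) (const 1)) sub)))
        (z := cons (ofList (l ++ r)) (cons (ofList (a :: m)) (num l.length)))
        (by simp [eval, ofList_cons]))
      (ih (a :: m))
    rw [List.reverse_cons, List.append_assoc, List.singleton_append]
    refine h.mono ?_
    simp only [weight, List.length_cons]
    omega

end Prog

/-! ## Computing the revealing chains -/

namespace Distribution

variable (D : Distribution)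

/-- The code of the possible transitions from the state `2 * j + 1`. -/
noncomputable def successors (j : ℕ) : Data :=
  if j = 0 then ofList [cons (num ((2 * j : ℕ) : ℝ)) (num (D.probNat j / D.cumulative (j + 1)))]
  else ofList [cons (num ((2 * j - 1 : ℕ) : ℝ)) (num (D.cumulative j / D.cumulative (j + 1))),
    cons (num ((2 * j : ℕ) : ℝ)) (num (D.probNat j / D.cumulative (j + 1)))]

/-- The description of the state `2 * j + 1`: threshold, successors, and the transitions. -/
noncomputable def entry (j : ℕ) : Data :=
  cons (num (D.pointNat j))
    (cons (num ((2 * j : ℕ) : ℝ)) (cons (num ((2 * j - 1 : ℕ) : ℝ)) (D.successors j)))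

/-- The descriptions of the states `2 * j - 1, …, 3, 1`. -/
noncomputable def stack : ℕ → Data
  | 0 => .nil
  | j + 1 => cons (D.entry j) (stack j)

/-- The codes of the states `2 * j` and `2 * j + 1`. -/
noncomputable def statePair (j : ℕ) : List Data :=
  [cons .nil (num (D.pointNat j)), cons (num 0) (D.successors j)]

theorem encode_eq : D.encode = ofList ((List.range' 0 D.supportSize).map fun j =>
    cons (num (D.pointNat j)) (num (D.probNat j))) := by
  rw [encode, ← List.range_eq_range', ← List.map_coe_finRange_eq_range, List.map_map]
  congr 1
  refine List.map_congr_left fun j _ => ?_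
  simp [probNat_fin, pointNat_fin]

/-- Groups the states by support point, the form in which `statesLoop` produces them. -/
theorem map_finRange_two_mul (k : ℕ) (f : Fin (2 * k) → Data) (g : ℕ → List Data)
    (h : ∀ j (hj : j < k), g j = [f ⟨2 * j, by omega⟩, f ⟨2 * j + 1, by omega⟩]) :
    (List.finRange (2 * k)).map f = (List.range k).flatMap g := by
  induction k with
  | zero => rfl
  | succ k ih =>
    have e : (List.finRange (2 * (k + 1))).map f =
        (List.finRange (2 * k)).map (fun i => f (Fin.castLE (by omega) i)) ++
          [f ⟨2 * k, by omega⟩, f ⟨2 * k + 1, by omega⟩] := by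
      change (List.finRange (2 * k + 1 + 1)).map f = _
      rw [List.finRange_succ_last, List.finRange_succ_last]
      simp only [List.map_append, List.map_map, List.map_cons, List.map_nil, List.append_assoc]
      rfl
    rw [e, ih (fun i => f (Fin.castLE (by omega) i)) fun j hj => h j (by omega), List.range_succ,
      List.flatMap_append, List.flatMap_singleton, h k (by omega)]

variable {D} in
theorem trans_yes_eq {s : Fin D.chain.numStates} (hs : s ∉ D.chain.terminals) :
    D.chain.trans s (yes s) = D.probNat (s / 2) / D.cumulative (s / 2 + 1) := by
  rw [mem_terminals] at hs
  change D.transNat s (s - 1) = _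
  rw [transNat, if_pos (by omega)]

variable {D} in
theorem trans_no_eq {s : Fin D.chain.numStates} (hs : 1 < (s : ℕ)) :
    D.chain.trans s (no s) = D.cumulative (s / 2) / D.cumulative (s / 2 + 1) := by
  change D.transNat s (s - 2) = _
  rw [transNat, if_neg (by omega), if_pos (by omega)]

variable {D} in
-- Both lists are strictly increasing and have the same elements, hence are equal. The order matters
-- because the code of the chain must be reproduced exactly; at state `1` the two successors
-- coincide and are listed once.
theorem filter_trans_pos {s : Fin D.chain.numStates} (hs : s ∉ D.chain.terminals) :
    ((List.finRange D.chain.numStates).filter fun r => 0 < D.chain.trans s r) =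
      if (s : ℕ) / 2 = 0 then [yes s] else [no s, yes s] := by
  have hs' := hs
  rw [mem_terminals] at hs'
  refine List.Perm.eq_of_pairwise (le := (· < ·)) (fun a b _ _ h1 h2 => absurd h1 h2.asymm)
    ((List.pairwise_lt_finRange _).filter _) ?_ ?_
  · split_ifs with h
    · exact List.pairwise_singleton _ _
    · refine List.pairwise_pair.2 (Fin.lt_def.2 ?_)
      simp only [no, yes]; omega
  · refine (List.perm_ext_iff_of_nodup ((List.nodup_finRange _).filter _) ?_).2 fun r => ?_
    · split_ifs with h
      · exact List.nodup_singleton _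
      · refine List.nodup_cons.2 ⟨fun h' => ?_, List.nodup_singleton _⟩
        rw [List.mem_singleton] at h'
        have := Fin.val_eq_of_eq h'
        simp only [no, yes] at this; omega
    · simp only [List.mem_filter, List.mem_finRange, true_and, decide_eq_true_eq]
      constructor
      · intro hr
        change 0 < D.transNat s r at hr
        unfold transNat at hr
        split_ifs at hr with h1 h2
        · have : r = yes s := Fin.ext (by simp only [yes]; omega)
          split_ifs <;> simp [this]
        · have : r = no s := Fin.ext (by simp only [no]; omega)
          rw [if_neg (by omega)]; simp [this]
        · exact absurd hr (lt_irrefl _)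
      · intro hr
        split_ifs at hr
        · rw [List.mem_singleton.1 hr]; exact trans_yes_pos hs
        · rcases List.mem_pair.1 hr with rfl | rfl
          · exact trans_no_pos hs
          · exact trans_yes_pos hs

theorem encode_chain : D.chain.encode = cons (num ((2 * D.supportSize - 1 : ℕ) : ℝ))
    (ofList ((List.range D.supportSize).flatMap D.statePair)) := by
  have hroot : ofFin D.chain.root = num ((2 * D.supportSize - 1 : ℕ) : ℝ) := rfl
  rw [MarkovChain.encode, hroot]
  congr 2
  have key : ∀ f : Fin D.chain.numStates → Data,
      (∀ j (hj : j < D.supportSize), D.statePair j = [f ⟨2 * j, by rw [chain_numStates]; omega⟩,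
        f ⟨2 * j + 1, by rw [chain_numStates]; omega⟩]) →
      (List.finRange D.chain.numStates).map f = (List.range D.supportSize).flatMap D.statePair :=
    fun f hf => map_finRange_two_mul _ f _ hf
  refine key _ fun j hj => ?_
  obtain ⟨a, ha⟩ : ∃ a : Fin D.chain.numStates, a = ⟨2 * j, by rw [chain_numStates]; omega⟩ :=
    ⟨_, rfl⟩
  obtain ⟨b, hb⟩ : ∃ b : Fin D.chain.numStates, b = ⟨2 * j + 1, by rw [chain_numStates]; omega⟩ :=
    ⟨_, rfl⟩
  have hav : (a : ℕ) = 2 * j := by rw [ha]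
  have hbv : (b : ℕ) = 2 * j + 1 := by rw [hb]
  have h0 : a ∈ D.chain.terminals := by rw [D.mem_terminals]; omega
  have h1 : b ∉ D.chain.terminals := by rw [D.mem_terminals]; omega
  have hhalf : (b : ℕ) / 2 = j := by omega
  have hv : D.chain.value a = D.pointNat j := by
    change D.pointNat (a / 2) = _
    congr 1; omega
  have hc : D.chain.cost b = 0 := rfl
  have hyes : ofFin (yes b) = num ((2 * j : ℕ) : ℝ) := by
    change num ((b - 1 : ℕ) : ℝ) = _
    rw [hbv, Nat.add_sub_cancel]
  have hno : ofFin (no b) = num ((2 * j - 1 : ℕ) : ℝ) := by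
    change num ((b - 2 : ℕ) : ℝ) = _
    rw [hbv]; rfl
  rw [← ha, ← hb, if_pos h0, if_neg h1, hv, hc, statePair, successors, filter_trans_pos h1, hhalf]
  split_ifs with h
  · rw [List.map_singleton, hyes, trans_yes_eq h1, hhalf]
  · rw [List.map_cons, List.map_singleton, hyes, hno, trans_yes_eq h1, trans_no_eq (by omega),
      hhalf]

end Distribution

namespace Prog

/-- One step of the computation of `Distribution.stack` from the code of a distribution. -/
def stackStep : Prog :=
  comp (pair id (comp (pair (comp snd (comp snd (comp snd snd))) (comp fst (comp fst snd))) add))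
    (pair (comp fst (comp fst snd))
      (pair
        (pair
          (pair (comp fst (comp fst (comp fst fst)))
            (pair (comp fst (comp snd (comp snd fst)))
              (pair (comp fst (comp snd (comp snd (comp snd fst))))
                (comp
                  (pair id (pair (pair (comp fst (comp snd (comp snd fst)))
                    (comp (pair (comp fst (comp fst (comp fst snd))) snd) div)) nil))
                  (ite (comp fst (comp fst (comp snd fst)))
                    (pair (pair (comp fst (comp fst (comp snd (comp snd (comp snd fst)))))
                      (comp (pair (comp fst (comp fst (comp snd (comp snd (comp snd snd)))))
                        (comp fst snd)) div)) snd)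
                    snd)))))
          (comp fst (comp snd fst)))
        (pair (comp (pair (comp fst (comp snd (comp snd fst))) (const 2)) add)
          (pair (comp (pair (comp fst (comp snd (comp snd fst))) (const 1)) add) snd))))

def stackLoop : Prog := loop (comp fst isCons) stackStep

/-- The state of `stackLoop` after the first `j` support points, `m` more being left. -/
noncomputable def stackState (D : Distribution) (j m : ℕ) : Data :=
  cons (ofList ((List.range' j m).map fun i => cons (num (D.pointNat i)) (num (D.probNat i))))
    (cons (D.stack j) (cons (num ((2 * j : ℕ) : ℝ)) (cons (num ((2 * j - 1 : ℕ) : ℝ))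
      (num (D.cumulative j)))))

/-- An empty stack is how the program recognises `j = 0`, where the only successor is the state `0`.
-/
theorem eval_stackStep_nil (l : Data) {y p c d P : ℝ} (h : P + p ≠ 0) :
    stackStep.eval (cons (cons (cons (num y) (num p)) l)
      (cons .nil (cons (num c) (cons (num d) (num P))))) =
    some (cons l (cons (cons (cons (num y) (cons (num c) (cons (num d)
      (ofList [cons (num c) (num (p / (P + p)))])))) .nil)
      (cons (num (c + 2)) (cons (num (c + 1)) (num (P + p)))))) := by
  simp [stackStep, eval, h, ofList]

theorem eval_stackStep_cons (l e s : Data) {y p c d P : ℝ} (h : P + p ≠ 0) :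
    stackStep.eval (cons (cons (cons (num y) (num p)) l)
      (cons (cons e s) (cons (num c) (cons (num d) (num P))))) =
    some (cons l (cons (cons (cons (num y) (cons (num c) (cons (num d)
      (ofList [cons (num d) (num (P / (P + p))), cons (num c) (num (p / (P + p)))]))))
      (cons e s)) (cons (num (c + 2)) (cons (num (c + 1)) (num (P + p)))))) := by
  simp [stackStep, eval, h, ofList]

theorem eval_stackStep (D : Distribution) (j m : ℕ) :
    stackStep.eval (stackState D j (m + 1)) = some (stackState D (j + 1) m) := by
  have hP := (D.cumulative_succ_pos j).ne'
  have e1 : ((2 * (j + 1) : ℕ) : ℝ) = ((2 * j : ℕ) : ℝ) + 2 := by push_cast; ring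
  -- The new value comes from `2 * j` and not from `2 * j - 1`, which is truncated to `0` at `j =
  -- 0`.
  have e2 : ((2 * (j + 1) - 1 : ℕ) : ℝ) = ((2 * j : ℕ) : ℝ) + 1 := by
    rw [← Nat.cast_succ]; congr 1
  rw [D.cumulative_succ] at hP
  rw [stackState, stackState, List.range'_succ, List.map_cons, ofList_cons, e1, e2,
    D.cumulative_succ, Distribution.stack, Distribution.entry, Distribution.successors,
    D.cumulative_succ]
  cases j with
  | zero => rw [Distribution.stack, eval_stackStep_nil _ hP, if_pos rfl]
  | succ j => rw [Distribution.stack, eval_stackStep_cons _ _ _ hP, if_neg (Nat.succ_ne_zero j)]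

theorem computes_stackLoop (D : Distribution) (j m : ℕ) :
    stackLoop.Computes (stackState D j m) (stackState D (j + m) 0)
      ((stackStep.weight + 4) * m + 4) := by
  induction m generalizing j with
  | zero => exact computes_loop_exit (by simp [eval, stackState, ofList_nil])
  | succ m ih =>
    have h := Computes.loop_step (c := comp fst isCons) (y := .num 1) (x := stackState D j (m + 1))
      (by simp [eval, stackState, List.range'_succ, ofList_cons]) (by simp)
      (computes_of_eval (eval_stackStep D j m)) (ih (j + 1))
    rw [show j + 1 + m = j + (m + 1) by omega] at h
    refine h.mono ?_
    simp only [weight]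
    ring_nf
    omega

/-- Maps the pair of `Distribution.stack` and a list to the pair of `[]` and the list preceded by
the codes of the states. -/
def statesLoop : Prog :=
  loop (comp fst isCons)
    (pair (comp fst snd)
      (pair (pair nil (comp fst (comp fst fst)))
        (pair (pair (const 0) (comp fst (comp fst (comp snd (comp snd snd))))) snd)))

/-- The largest state is on top of the stack, so prepending while popping lists the states in
increasing order. -/
theorem computes_statesLoop (D : Distribution) (j : ℕ) (l : List Data) :
    statesLoop.Computes (cons (D.stack j) (ofList l))
      (cons .nil (ofList ((List.range j).flatMap D.statePair ++ l))) (40 * j + 4) := by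
  induction j generalizing l with
  | zero => exact computes_loop_exit (by simp [eval, Distribution.stack])
  | succ j ih =>
    have h := Computes.loop_step (c := comp fst isCons) (y := .num 1)
      (x := cons (D.stack (j + 1)) (ofList l))
      (by simp [eval, Distribution.stack]) (by simp)
      (computes_of_eval (z := cons (D.stack j) (ofList (D.statePair j ++ l)))
        (by simp [eval, Distribution.stack, Distribution.entry, Distribution.statePair,
          ofList_cons]))
      (ih (D.statePair j ++ l))
    rw [List.range_succ, List.flatMap_append, List.flatMap_singleton, List.append_assoc]
    refine h.mono ?_
    simp only [weight]
    omega

/-- Maps the code of a distribution to the code of its revealing chain and its stack. -/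
def makeChain : Prog :=
  comp (pair id (pair nil (pair (const 0) (pair (const 0) (const 0)))))
    (comp stackLoop
      (comp (pair (pair (comp snd fst) nil) (pair (comp snd (comp snd (comp snd fst))) (comp snd fst)))
        (comp (pair (comp fst statesLoop) snd)
          (pair (pair (comp snd fst) (comp fst snd)) (comp snd snd)))))

theorem computes_makeChain (D : Distribution) :
    makeChain.Computes D.encode (cons D.chain.encode (D.stack D.supportSize))
      (200 * D.supportSize + 200) := by
  have h1 := computes_of_eval (p := pair id (pair nil (pair (const 0) (pair (const 0) (const 0)))))
    (x := D.encode) (z := stackState D 0 D.supportSize)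
    (by simp [eval, stackState, D.encode_eq, Distribution.stack, D.cumulative_zero])
  have h2 := computes_stackLoop D 0 D.supportSize
  rw [zero_add] at h2
  have h3 := computes_of_eval
    (p := pair (pair (comp snd fst) nil) (pair (comp snd (comp snd (comp snd fst))) (comp snd fst)))
    (x := stackState D D.supportSize 0)
    (z := cons (cons (D.stack D.supportSize) (ofList []))
      (cons (num ((2 * D.supportSize - 1 : ℕ) : ℝ)) (D.stack D.supportSize)))
    (by simp [eval, stackState, ofList_nil])
  have h4 := ((computes_of_eval (p := fst)
    (x := cons (cons (D.stack D.supportSize) (ofList []))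
      (cons (num ((2 * D.supportSize - 1 : ℕ) : ℝ)) (D.stack D.supportSize))) (by rfl)).comp
    (computes_statesLoop D D.supportSize [])).pair (computes_of_eval (p := snd) (by rfl))
  have h5 := computes_of_eval (p := pair (pair (comp snd fst) (comp fst snd)) (comp snd snd))
    (x := cons (cons .nil (ofList ((List.range D.supportSize).flatMap D.statePair ++ [])))
      (cons (num ((2 * D.supportSize - 1 : ℕ) : ℝ)) (D.stack D.supportSize)))
    (z := cons D.chain.encode (D.stack D.supportSize))
    (by simp [eval, D.encode_chain])
  refine (h1.comp (h2.comp (h3.comp (h4.comp h5)))).mono ?_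
  simp only [weight, stackStep]
  omega

/-- Maps `(l, c, s)`, where `l` is a reversed list of codes of distributions, to `([], c', s')`,
where the codes of the chains and the stacks are put in front of `c` and `s`. -/
def makeChains : Prog :=
  loop (comp fst isCons)
    (comp (pair (comp (comp fst fst) makeChain) id)
      (pair (comp snd (comp fst snd))
        (pair (pair (comp fst fst) (comp snd (comp snd fst)))
          (pair (comp fst snd) (comp snd (comp snd snd))))))

theorem computes_makeChains (l : List Distribution) (c s : List Data) :
    makeChains.Computes
      (cons (ofList ((l.map Distribution.encode).reverse)) (cons (ofList c) (ofList s)))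
      (cons .nil (cons (ofList (l.map (fun D => D.chain.encode) ++ c))
        (ofList (l.map (fun D => D.stack D.supportSize) ++ s))))
      ((l.map fun D => 200 * D.supportSize + 300).sum + 4) := by
  induction l using List.reverseRecOn generalizing c s with
  | nil => exact computes_loop_exit (by simp [eval, ofList_nil])
  | append_singleton l D ih =>
    have hin : (cons (ofList (((l ++ [D]).map Distribution.encode).reverse))
        (cons (ofList c) (ofList s))) = cons (cons D.encode
          (ofList ((l.map Distribution.encode).reverse))) (cons (ofList c) (ofList s)) := by
      simp [ofList_cons]
    rw [hin]
    have h1 := ((computes_of_eval (p := comp fst fst) (x := cons (cons D.encode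
          (ofList ((l.map Distribution.encode).reverse))) (cons (ofList c) (ofList s)))
          (z := D.encode) (by simp [eval])).comp (computes_makeChain D)).pair
          (computes_of_eval (p := id) (by rfl))
    have h2 := h1.comp (computes_of_eval
      (p := pair (comp snd (comp fst snd))
        (pair (pair (comp fst fst) (comp snd (comp snd fst)))
          (pair (comp fst snd) (comp snd (comp snd snd)))))
      (z := cons (ofList ((l.map Distribution.encode).reverse))
        (cons (ofList (D.chain.encode :: c)) (ofList (D.stack D.supportSize :: s))))
      (by simp [eval, ofList_cons]))
    have h := Computes.loop_step (c := comp fst isCons) (y := .num 1)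
      (by simp [eval]) (by simp) h2
      (ih (D.chain.encode :: c) (D.stack D.supportSize :: s))
    simp only [List.map_append, List.map_cons, List.map_nil, List.append_assoc,
      List.singleton_append, List.sum_append, List.sum_cons, List.sum_nil]
    refine h.mono ?_
    simp only [weight]
    omega

end Prog

end CICS

namespace CICS

open Data Prog

namespace Prog

/-! ## The simulating program -/

/-- The memory of the simulating program: the memory of the simulated program, and for each answer
to the latest request the answer to be passed on and the new list of stacks. -/
def simMemory (m a l b l' : Data) : Data := cons (cons m (cons (cons a l) (cons b l'))) (num 0)

/-- Whether the memory still is the input of the simulating program. -/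
def isFirstRound : Prog :=
  ite (comp fst snd) (ite (comp fst (comp snd isCons)) (const 1) nil) (const 1)

/-- The list of distributions is reversed first because `makeChains` prepends its results. -/
def startRound : Prog :=
  comp (pair (comp fst fst) (comp (comp fst (comp snd (pair id nil))) reverseOnto))
    (comp (pair fst (comp (comp snd (comp snd (pair id (pair nil nil)))) makeChains))
      (pair (pair (pair fst (comp snd (comp snd fst))) nil) (comp snd (comp snd snd))))

def laterRound : Prog :=
  ite snd
    (pair (pair (comp fst (comp fst fst)) (comp fst (comp fst (comp snd (comp fst fst)))))
      (comp fst (comp fst (comp snd (comp fst snd)))))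
    (pair (pair (comp fst (comp fst fst)) (comp fst (comp fst (comp snd (comp snd fst)))))
      (comp fst (comp fst (comp snd (comp snd snd)))))

/-- Produces the input of the simulated program and the list of stacks. -/
def preprocess : Prog := ite isFirstRound startRound laterRound

def onHalt : Prog := pair nil (pair (const 0) nil)

def onToss : Prog :=
  pair (pair (pair (comp fst fst) (pair (pair (const 1) snd) (pair nil snd))) (const 0))
    (pair (const 2) nil)

/-- Both outcomes are prepared before the probe. Success passes on the terminal state and keeps all
stacks, since the stack of a finished chain is not needed again; failure passes on the lower state
and pops the stack at position `i`, reached by unzipping the list. -/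
def onAdvance : Prog :=
  comp (pair id (comp (pair snd (pair nil (comp fst (comp snd snd)))) unzipTo))
    (comp (pair id (comp (pair (comp snd (comp snd fst))
        (pair (comp snd (comp fst (comp fst snd))) (comp snd (comp fst snd)))) reverseOnto))
      (pair
        (pair (pair (comp fst (comp fst (comp fst fst)))
          (pair
            (pair (comp fst (comp snd (comp fst (comp fst (comp fst (comp snd fst))))))
              (comp fst (comp fst snd)))
            (pair (comp fst (comp snd (comp fst (comp fst (comp fst (comp snd (comp snd fst)))))))
              (comp snd snd))))
          (const 0))
        (pair (const 1) (pair (comp fst (comp fst (comp fst (comp snd snd))))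
          (comp fst (comp snd (comp fst (comp fst (comp fst fst)))))))))

/-- Translates the request of the simulated program. -/
def postprocess : Prog :=
  ite (comp (pair (comp fst (comp snd fst)) (const 1)) lt) onHalt
    (ite (comp (pair (comp fst (comp snd fst)) (const 2)) lt) onAdvance onToss)

def simulate (T : Prog) : Prog := comp preprocess (comp (pair (comp fst T) snd) postprocess)

theorem computes_preprocess_later_true (m a l b l' : Data) :
    preprocess.Computes (cons (simMemory m a l b l') (ofBool true)) (cons (cons m a) l)
      preprocess.weight :=
  computes_of_eval (by simp [preprocess, isFirstRound, laterRound, simMemory, ofBool, eval])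

theorem computes_preprocess_later_false (m a l b l' : Data) :
    preprocess.Computes (cons (simMemory m a l b l') (ofBool false)) (cons (cons m b) l')
      preprocess.weight :=
  computes_of_eval (by simp [preprocess, isFirstRound, laterRound, simMemory, ofBool, eval])

/-- The first round is recognised by the second component of the memory: it is a list here, empty if
there are no elements, and a number in `simMemory`. -/
theorem computes_preprocess_first (c : Data) (l : List Distribution) :
    preprocess.Computes (cons (cons c (ofList (l.map Distribution.encode))) .nil)
      (cons (cons (cons c (ofList (l.map fun D => D.chain.encode))) .nil)
        (ofList (l.map fun D => D.stack D.supportSize)))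
      ((l.map fun D => 200 * D.supportSize + 313).sum + 200) := by
  have h0 := computes_of_eval (p := isFirstRound)
    (x := cons (cons c (ofList (l.map Distribution.encode))) .nil) (z := .num 1)
    (by cases l <;> simp [isFirstRound, eval, ofList])
  have h1 := (computes_of_eval (p := comp fst fst)
    (x := cons (cons c (ofList (l.map Distribution.encode))) .nil) (z := c)
    (by simp [eval])).pair ((computes_of_eval (p := comp fst (comp snd (pair id nil)))
      (x := cons (cons c (ofList (l.map Distribution.encode))) .nil)
      (z := cons (ofList (l.map Distribution.encode)) (ofList []))
      (by simp [eval, ofList_nil])).comp (computes_reverseOnto _ []))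
  rw [List.append_nil] at h1
  have h2 := (computes_of_eval (p := fst)
    (x := cons c (cons .nil (ofList (l.map Distribution.encode).reverse))) (z := c)
    (by simp [eval])).pair ((computes_of_eval (p := comp snd (comp snd (pair id (pair nil nil))))
      (x := cons c (cons .nil (ofList (l.map Distribution.encode).reverse)))
      (z := cons (ofList (l.map Distribution.encode).reverse) (cons (ofList []) (ofList [])))
      (by simp [eval, ofList_nil])).comp (computes_makeChains l [] []))
  rw [List.append_nil, List.append_nil] at h2
  have h3 := computes_of_eval
    (p := pair (pair (pair fst (comp snd (comp snd fst))) nil) (comp snd (comp snd snd)))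
    (x := cons c (cons .nil (cons (ofList (l.map fun D => D.chain.encode))
      (ofList (l.map fun D => D.stack D.supportSize)))))
    (z := cons (cons (cons c (ofList (l.map fun D => D.chain.encode))) .nil)
      (ofList (l.map fun D => D.stack D.supportSize)))
    (by simp [eval])
  refine (h0.ite_true (by simp) (h1.comp (h2.comp h3))).mono ?_
  have e : ∀ l : List Distribution, (l.map fun D => 200 * D.supportSize + 313).sum =
      (l.map fun D => 200 * D.supportSize + 300).sum + 13 * l.length := by
    intro l
    induction l with
    | nil => rfl
    | cons D l ih => simp only [List.map_cons, List.sum_cons, List.length_cons, ih]; ring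
  rw [e]
  simp only [weight, isFirstRound, List.length_map]
  omega

theorem computes_postprocess_halt (m r L : Data) :
    postprocess.Computes (cons (cons m (cons (num 0) r)) L) (cons .nil (cons (num 0) .nil))
      100 :=
  (computes_of_eval (p := comp (pair (comp fst (comp snd fst)) (const 1)) lt)
    (z := .num 1) (by simp [eval])).ite_true (by simp)
    (computes_of_eval (p := onHalt) (by simp [onHalt, eval])) |>.mono (by simp [weight, onHalt])

theorem computes_postprocess_toss (m r L : Data) :
    postprocess.Computes (cons (cons m (cons (num 2) r)) L)
      (cons (simMemory m (ofBool true) L (ofBool false) L) (cons (num 2) .nil)) 100 :=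
  (computes_of_eval (p := comp (pair (comp fst (comp snd fst)) (const 1)) lt)
    (z := .nil) (by simp [eval])).ite_false
    ((computes_of_eval (p := comp (pair (comp fst (comp snd fst)) (const 2)) lt)
      (z := .nil) (by simp [eval])).ite_false
    (computes_of_eval (p := onToss) (by simp [onToss, eval, simMemory, ofBool]))) |>.mono
      (by simp [weight, onToss])

theorem computes_onAdvance (m y a b e s : Data) (l r : List Data) :
    onAdvance.Computes
      (cons (cons m (cons (num 1) (num (l.length : ℕ))))
        (ofList (l ++ cons (cons y (cons a (cons b e))) s :: r)))
      (cons (simMemory m a (ofList (l ++ cons (cons y (cons a (cons b e))) s :: r)) b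
        (ofList (l ++ s :: r))) (cons (num 1) (cons (num (l.length : ℕ)) y)))
      (40 * l.length + 200) := by
  set st := cons (cons y (cons a (cons b e))) s with hst
  set x := cons (cons m (cons (num 1) (num (l.length : ℕ)))) (ofList (l ++ st :: r)) with hx
  have h1 := (computes_of_eval (p := id) (x := x) (by rfl)).pair
    ((computes_of_eval (p := pair snd (pair nil (comp fst (comp snd snd)))) (x := x)
      (z := cons (ofList (l ++ st :: r)) (cons (ofList []) (num (l.length : ℕ))))
      (by simp [eval, hx, ofList_nil])).comp (computes_unzipTo l (st :: r) []))
  rw [List.append_nil] at h1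
  set x' := cons x (cons (ofList (st :: r)) (cons (ofList l.reverse) (num 0))) with hx'
  have h2 := (computes_of_eval (p := id) (x := x') (by rfl)).pair
    ((computes_of_eval (p := pair (comp snd (comp snd fst))
        (pair (comp snd (comp fst (comp fst snd))) (comp snd (comp fst snd)))) (x := x')
      (z := cons (ofList l.reverse) (ofList (s :: r)))
      (by simp [eval, hx', hst, ofList_cons])).comp (computes_reverseOnto l.reverse (s :: r)))
  rw [List.reverse_reverse, List.length_reverse] at h2
  have h3 := h1.comp (h2.comp (computes_of_eval (p := pair
        (pair (pair (comp fst (comp fst (comp fst fst)))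
          (pair
            (pair (comp fst (comp snd (comp fst (comp fst (comp fst (comp snd fst))))))
              (comp fst (comp fst snd)))
            (pair (comp fst (comp snd (comp fst (comp fst (comp fst (comp snd (comp snd fst)))))))
              (comp snd snd))))
          (const 0))
        (pair (const 1) (pair (comp fst (comp fst (comp fst (comp snd snd))))
          (comp fst (comp snd (comp fst (comp fst (comp fst fst))))))))
      (z := cons (simMemory m a (ofList (l ++ st :: r)) b (ofList (l ++ s :: r)))
        (cons (num 1) (cons (num (l.length : ℕ)) y)))
      (by simp [eval, hx', hx, hst, ofList_cons, simMemory])))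
  refine h3.mono ?_
  simp only [weight]
  omega

theorem computes_postprocess_advance (m y a b e s : Data) (L : List Data) (i : ℕ)
    (hi : L[i]? = some (cons (cons y (cons a (cons b e))) s)) :
    postprocess.Computes (cons (cons m (cons (num 1) (num (i : ℝ)))) (ofList L))
      (cons (simMemory m a (ofList L) b (ofList (L.set i s)))
        (cons (num 1) (cons (num (i : ℝ)) y))) (40 * L.length + 300) := by
  obtain ⟨hlt, hget⟩ := List.getElem?_eq_some_iff.1 hi
  have hlen : (L.take i).length = i := by rw [List.length_take]; omega
  have hL : L = L.take i ++ cons (cons y (cons a (cons b e))) s :: L.drop (i + 1) := by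
    rw [← hget, List.cons_getElem_drop_succ, List.take_append_drop]
  have hset : L.set i s = L.take i ++ s :: L.drop (i + 1) := by
    rw [List.set_eq_take_append_cons_drop, if_pos hlt]
  have h := computes_onAdvance m y a b e s (L.take i) (L.drop (i + 1))
  rw [hlen, ← hL, ← hset] at h
  have h1 := computes_of_eval (p := comp (pair (comp fst (comp snd fst)) (const 1)) lt)
    (x := cons (cons m (cons (num 1) (num (i : ℝ)))) (ofList L)) (z := .nil) (by simp [eval])
  have h2 := computes_of_eval (p := comp (pair (comp fst (comp snd fst)) (const 2)) lt)
    (x := cons (cons m (cons (num 1) (num (i : ℝ)))) (ofList L)) (z := .num 1) (by simp [eval])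
  refine (h1.ite_false (h2.ite_true (by simp) h)).mono ?_
  simp only [weight]
  omega

theorem computes_simulate {T : Prog} {x m a L z w : Data} {t u v : ℕ}
    (h1 : preprocess.Computes x (cons (cons m a) L) t) (h2 : Exec T (cons m a) z u)
    (h3 : postprocess.Computes (cons z L) w v) :
    (simulate T).Computes x w (t + u + v + 10) := by
  have hT : Prog.Computes T (cons m a) z u := ⟨u, le_rfl, h2⟩
  refine (h1.comp (((((computes_of_eval (p := fst) (x := cons (cons m a) L) (by rfl)).comp
    hT)).pair (computes_of_eval (p := snd) (by rfl))).comp h3)).mono ?_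
  simp only [weight]
  omega

end Prog

/-! ## Correctness of the simulation -/

theorem SemiOnline.RunBy.mono {n : ℕ} {B : Prog} {β : SemiOnline n} {mem ans : Data} {t u : ℕ}
    (h : β.RunBy B mem ans t) (htu : t ≤ u) : β.RunBy B mem ans u := by
  induction β generalizing mem ans t u with
  | halt =>
    obtain ⟨m, v, hv, h⟩ := h
    exact ⟨m, v, hv.trans htu, h⟩
  | probe i τ acc rej ih1 ih2 =>
    obtain ⟨m, v, hv, h, ha, hr⟩ := h
    exact ⟨m, v, hv.trans htu, h, ih1 ha (Nat.sub_le_sub_right htu v),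
      ih2 hr (Nat.sub_le_sub_right htu v)⟩
  | toss next ih =>
    obtain ⟨m, v, hv, h, hn⟩ := h
    exact ⟨m, v, hv.trans htu, h, fun b => ih b (hn b) (Nat.sub_le_sub_right htu v)⟩

section

variable {n : ℕ} {D : Fin n → Distribution}

open CICS.Distribution

/-- The list `L` of stacks describes the states of the unfinished chains. -/
def TracksStacks (L : List Data) (h : History (chains D)) : Prop :=
  L.length = n ∧ ∀ i, (h i).1 ∉ (D i).chain.terminals →
    L[(i : ℕ)]? = some ((D i).stack ((h i).1 / 2 + 1))

theorem TracksStacks.init :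
    TracksStacks ((List.finRange n).map fun i => (D i).stack (D i).supportSize)
      (History.init (chains D)) := by
  refine ⟨by simp, fun i _ => ?_⟩
  have := (D i).supportSize_pos
  have e : ((History.init (chains D) i).1 : ℕ) / 2 + 1 = (D i).supportSize := by
    change (2 * (D i).supportSize - 1) / 2 + 1 = _
    omega
  rw [e]
  simp

theorem TracksStacks.move_yes {L : List Data} {h : History (chains D)} (hL : TracksStacks L h)
    {i : Fin n} (hi : (h i).1 ∉ (D i).chain.terminals) :
    TracksStacks L (h.move i (yes (h i).1)) := by
  refine ⟨hL.1, fun j hj => ?_⟩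
  by_cases hji : j = i
  · subst hji
    rw [History.move_same] at hj
    exact absurd (yes_mem_terminals hi) hj
  · rw [History.move_ne hji] at hj ⊢
    exact hL.2 j hj

/-- Popping one entry leads from state `2 * j + 1` to `2 * j - 1`. At state `1` the stack becomes
empty, but the chain is then at the terminal state `0`, about which nothing is claimed. -/
theorem TracksStacks.move_no {L : List Data} {h : History (chains D)} (hL : TracksStacks L h)
    {i : Fin n} :
    TracksStacks (L.set i ((D i).stack ((h i).1 / 2))) (h.move i (no (h i).1)) := by
  refine ⟨by rw [List.length_set, hL.1], fun j hj => ?_⟩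
  by_cases hji : j = i
  · subst hji
    rw [History.move_same] at hj ⊢
    rw [mem_terminals] at hj
    have e : (no (h j).1 : ℕ) / 2 + 1 = (h j).1 / 2 := by simp only [no] at hj ⊢; omega
    simp only [e]
    rw [List.getElem?_set_self (by rw [hL.1]; exact j.2)]
  · rw [History.move_ne hji] at hj ⊢
    rw [List.getElem?_set_ne (fun h' => hji (Fin.ext h'.symm))]
    exact hL.2 j hj

/-- The program `simulate T` carries out the semi-online algorithm obtained from the policy that
`T` carries out. The time that it needs to restore the input of `T` is accounted for in `c`, and
all other overhead by the factor. -/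
theorem Policy.RunBy.simulate {F : Constraint n} {coins : Bool} {T : Prog} {π : Policy (chains D)}
    {h : History (chains D)} {mem ans : Data} {t : ℕ} (hrun : π.RunBy T mem ans h t)
    (hv : π.ValidFrom F coins h) {L : List Data} (hL : TracksStacks L h) {bmem bans : Data} {c : ℕ}
    (hpre : preprocess.Computes (.cons bmem bans) (.cons (.cons mem ans) (ofList L)) c) :
    (π.toSemiOnline h).RunBy (simulate T) bmem bans
      (c + (40 * n + 311 + preprocess.weight) * t) := by
  set K := 40 * n + 311 + preprocess.weight with hK
  -- The terms are the `u` simulated steps, at most `40 * n + 300` for translating the request, `10`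
  -- for composition, the preprocessing of the next round, and the remaining budget. As `1 ≤ u`, a
  -- single `K` absorbs the overhead together with one simulated step.
  have hbudget : ∀ {u t : ℕ}, 1 ≤ u → u ≤ t →
      u + (40 * n + 310) + preprocess.weight + K * (t - u) ≤ K * t := by
    intro u t hu hut
    obtain ⟨d, rfl⟩ := Nat.exists_eq_add_of_le hut
    obtain ⟨v, rfl⟩ := Nat.exists_eq_add_of_le hu
    rw [Nat.add_sub_cancel_left]
    have : v ≤ K * v := Nat.le_mul_of_pos_left v (by omega)
    have e : K * (1 + v + d) = K + K * v + K * d := by ring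
    omega
  induction π generalizing h mem ans t L bmem bans c with
  | halt S =>
    obtain ⟨m, l, u, -, -, hut, hex⟩ := hrun
    have hb := hbudget (one_le_of_exec hex) hut
    obtain ⟨a, ha, hex'⟩ := computes_simulate hpre hex (computes_postprocess_halt m _ _)
    exact ⟨_, a, by omega, hex'⟩
  | advance i next ih =>
    obtain ⟨m, u, hut, hex, hnext⟩ := hrun
    have hi : (h i).1 ∉ (D i).chain.terminals := hv.1
    have hyes := trans_yes_pos hi
    have hno := trans_no_pos hi
    have hb := hbudget (one_le_of_exec hex) hut
    have hi' := hi
    rw [mem_terminals] at hi'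
    have hget := hL.2 i hi
    rw [stack, entry] at hget
    obtain ⟨a, ha, hex'⟩ := computes_simulate hpre hex
      (computes_postprocess_advance m _ _ _ _ _ L i hget)
    have e1 : num ((2 * ((h i).1 / 2) : ℕ) : ℝ) = ofFin (yes (h i).1) := by
      change _ = num (((h i).1 - 1 : ℕ) : ℝ)
      congr 2; omega
    have e2 : num ((2 * ((h i).1 / 2) - 1 : ℕ) : ℝ) = ofFin (no (h i).1) := by
      change _ = num (((h i).1 - 2 : ℕ) : ℝ)
      congr 2; omega
    rw [e1, e2] at hex'
    rw [hL.1] at ha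
    refine ⟨_, a, by omega, hex', ?_, ?_⟩
    · exact (ih _ (hnext _ hyes) (hv.2 _ hyes) (hL.move_yes hi)
        (computes_preprocess_later_true _ _ _ _ _)).mono (by omega)
    · exact (ih _ (hnext _ hno) (hv.2 _ hno) hL.move_no
        (computes_preprocess_later_false _ _ _ _ _)).mono (by omega)
  | toss next ih =>
    obtain ⟨m, u, hut, hex, hnext⟩ := hrun
    have hb := hbudget (one_le_of_exec hex) hut
    obtain ⟨a, ha, hex'⟩ := computes_simulate hpre hex (computes_postprocess_toss m _ _)
    refine ⟨_, a, by omega, hex', fun b => ?_⟩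
    cases b
    · exact (ih _ (hnext _) (hv.2 _) hL
        (computes_preprocess_later_false _ _ _ _ _)).mono (by omega)
    · exact (ih _ (hnext _) (hv.2 _) hL
        (computes_preprocess_later_true _ _ _ _ _)).mono (by omega)

theorem computes_preprocess_input (c : Data) (D : Fin n → Distribution) :
    preprocess.Computes (.cons (.cons c (encodeDistributions D)) .nil)
      (.cons (.cons (.cons c (encodeChains (chains D))) .nil)
        (ofList ((List.finRange n).map fun i => (D i).stack (D i).supportSize)))
      (∑ i, (200 * (D i).supportSize + 313) + 200) := by
  have h := computes_preprocess_first c ((List.finRange n).map D)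
  simp only [List.map_map] at h
  have e : ∑ i, (200 * (D i).supportSize + 313) =
      ((List.finRange n).map ((fun D : Distribution => 200 * D.supportSize + 313) ∘ D)).sum :=
    (Fin.sum_univ_def _)
  rw [e]
  exact h

theorem chain_size (D : Distribution) : D.chain.size ≤ 4 * D.supportSize := by
  have h1 := D.chain.terminalsᶜ.card_le_univ
  rw [Fintype.card_fin] at h1
  have h2 : D.chain.numStates = 2 * D.supportSize := rfl
  rw [MarkovChain.size]
  omega

theorem card_le_sum_supportSize (D : Fin n → Distribution) : n ≤ ∑ i, (D i).supportSize := by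
  calc n = ∑ _i : Fin n, 1 := by simp
    _ ≤ _ := Finset.sum_le_sum fun i _ => (D i).supportSize_pos

end

/-! ### The polynomial time bound and the conclusion. -/

theorem eval_mono_nat (P : Polynomial ℕ) {a b : ℕ} (h : a ≤ b) : P.eval a ≤ P.eval b := by
  rw [Polynomial.eval_eq_sum_range, Polynomial.eval_eq_sum_range]
  gcongr

theorem EfficientPolicy.simulate {ι : Type*} {n : ι → ℕ} {F : (a : ι) → Constraint (n a)}
    {code : ι → Data} {coins : Bool} {T : Prog}
    {π : (a : ι) → (M : Fin (n a) → MarkovChain) → Policy M}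
    (hT : EfficientPolicy F code coins T π) (hpromise : ∀ a M, (π a M).PromiseOfPayment) :
    EfficientSemiOnline F code coins (simulate T)
      fun a D => (π a (chains D)).toSemiOnline (History.init (chains D)) := by
  obtain ⟨hv, P, hP⟩ := hT
  refine ⟨fun a D => Policy.toSemiOnline_validFrom (hv a _) (hpromise a _)
    History.reachable_init (Finset.empty_subset _), ?_⟩
  -- Here `513 = 200 + 313`, since `n a` is at most the total support size. The `4` accounts for two
  -- states per support point and at most as many actions as states.
  refine ⟨513 * .X + 200 + (40 * .X + 311 + .C preprocess.weight) * P.comp (4 * .X), fun a D => ?_⟩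
  refine ((hP a (chains D)).simulate (hv a _) TracksStacks.init
    (computes_preprocess_input (code a) D)).mono ?_
  have hn := card_le_sum_supportSize D
  have hsum : ∑ i, (200 * (D i).supportSize + 313) = 200 * ∑ i, (D i).supportSize + 313 * n a := by
    rw [Finset.sum_add_distrib, ← Finset.mul_sum]
    simp [mul_comm]
  have hsize : ∑ i, (chains D i).size ≤ 4 * ∑ i, (D i).supportSize := by
    rw [Finset.mul_sum]
    exact Finset.sum_le_sum fun i _ => chain_size (D i)
  simp only [Polynomial.eval_add, Polynomial.eval_mul, Polynomial.eval_comp, Polynomial.eval_X,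
    Polynomial.eval_C, Polynomial.eval_ofNat]
  have hmono := eval_mono_nat P (a := (code a).size + ∑ i, (chains D i).size)
    (b := 4 * ((code a).size + ∑ i, (D i).supportSize)) (by omega)
  refine add_le_add (by omega) (Nat.mul_le_mul (by omega) hmono)

end CICS

theorem theorem4p2 {ι : Type*} (n : ι → ℕ) (F : (a : ι) → CICS.Constraint (n a))
    (code : ι → CICS.Data) (coins : Bool) (α ε : ℝ) (hα : 0 < α) (hε : 0 < ε)
    (T : CICS.Prog) (π : (a : ι) → (M : Fin (n a) → CICS.MarkovChain) → CICS.Policy M)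
    (hT : CICS.EfficientPolicy F code coins T π)
    (hpromise : ∀ a M, (π a M).PromiseOfPayment)
    (happrox : ∀ a M, CICS.opt (F a) M ≤ α * (π a M).utility) :
    ∃ (B : CICS.Prog) (β : (a : ι) → (Fin (n a) → CICS.Distribution) → CICS.SemiOnline (n a)),
      CICS.EfficientSemiOnline F code coins B β ∧
      ∀ a D, CICS.exPost (F a) D ≤ (α + ε) * (β a D).val D := by
  refine ⟨_, _, hT.simulate hpromise, fun a D => ?_⟩
  have h1 := (CICS.exPost_le_opt (F a) D).trans (happrox a (CICS.chains D))
  rw [CICS.Policy.utility_eq_val (hT.1 a _) (hpromise a _)] at h1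
  -- The value of the algorithm is nonnegative because `0 ≤ exPost ≤ α * val`; so raising the factor
  -- from `α` to `α + ε` only weakens the bound.
  have h0 := nonneg_of_mul_nonneg_right ((CICS.exPost_nonneg (F a) D).trans h1) hα
  rw [add_mul]
  exact h1.trans (le_add_of_nonneg_right (mul_nonneg hε.le h0))
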